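/- A \emph{monoidal model category} is a bicomplete symmetric monoidal closed category $(\mathsf{M},\otimes,\mathbb{1})$ with a model structure that satisfies the \emph{pushout product axiom}: for all cofibrations $f:X_0\to X_1$ and $g:Y_0\to Y_1$, the pushout product $$f\mathbin\square g:\ (X_0\otimes Y_1)\coprod_{X_0\otimes Y_0}(X_1\otimes Y_0)\longrightarrow X_1\otimes Y_1$$ is a cofibration, and it is a trivial cofibration if, in addition, $f$ or $g$ is a weak equivalence. (No axiom on the unit and no cofibrant generation is required.) For a bicomplete symmetric monoidal closed category $\mathsf{C}$ with initial object $\varnothing$, the arrow category $\mathrm{Arr}(\mathsf{C})$, whose objects are the maps of $\mathsf{C}$ and whose maps are the commutative squares, is again a bicomplete symmetric monoidal closed category, with tensor product the pushout product and with unit $\varnothing\to\mathbb{1}$. Put $\mathsf{M}^{I^{\times 0}}=\mathsf{M}$ and $\mathsf{M}^{I^{\times (n+1)}}=\mathrm{Arr}(\mathsf{M}^{I^{\times n}})$, with this monoidal structure at each step; the objects of $\mathsf{M}^{I^{\times n}}$ are the commutative $n$-cubes in $\mathsf{M}$. \textbf{Corollary.} Let $\mathsf{M}$ be any monoidal model category,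 cofibrantly generated or not. Then for every $n\ge 0$ the category $\mathsf{M}^{I^{\times n}}$ of commutative $n$-cubes has a model structure, the projective one, in which a map is a weak equivalence (respectively, a fibration) if and only if its component at each of the $2^n$ vertices of the cube is a weak equivalence (respectively, a fibration) in $\mathsf{M}$; and with this model structure and the iterated pushout product monoidal structure, $\mathsf{M}^{I^{\times n}}$ is a monoidal model category. If the two factorizations of the model structure of $\mathsf{M}$ can be chosen functorially, then so can those of $\mathsf{M}^{I^{\times n}}$. -/

import Mathlib

universe v u

open CategoryTheory Limits MonoidalCategory HomotopicalAlgebra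

/-! ## The pushout product monoidal structure on the arrow category

For a symmetric monoidal closed category `C` with pushouts, pullbacks and an initial object, the
arrow category `Arrow C` is symmetric monoidal closed: the tensor product of two arrows is their
pushout product and the unit is `∅ ⟶ 𝟙`. -/

namespace PushoutProductMonoidal
noncomputable section

variable {C : Type u} [Category.{v} C] [MonoidalCategory C] [HasPushouts C]
  [HasInitial C] [SymmetricCategory C] [MonoidalClosed C]

set_option linter.unusedSectionVars false

/-- The pushout product `X □ Y : (X₁ ⊗ Y₀) ⊔ (X₀ ⊗ Y₁) ⟶ X₁ ⊗ Y₁` of two arrows. -/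
abbrev pp (X Y : Arrow C) : Arrow C :=
  Arrow.mk (Y := X.right ⊗ Y.right)
    (pushout.desc (f := X.hom ▷ Y.left) (g := X.left ◁ Y.hom)
      (X.right ◁ Y.hom) (X.hom ▷ Y.right) (whisker_exchange X.hom Y.hom).symm)

/-- This is the pushout product of Mathlib. -/
theorem pp_eq (X Y : Arrow C) : pp X Y = (Arrow.pushoutProduct.obj X).obj Y := rfl

/-- The coprojection `X₁ ⊗ Y₀ ⟶ (X □ Y)₀`. -/
def inl (X Y : Arrow C) : X.right ⊗ Y.left ⟶ (pp X Y).left :=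
  pushout.inl (X.hom ▷ Y.left) (X.left ◁ Y.hom)

/-- The coprojection `X₀ ⊗ Y₁ ⟶ (X □ Y)₀`. -/
def inr (X Y : Arrow C) : X.left ⊗ Y.right ⟶ (pp X Y).left :=
  pushout.inr (X.hom ▷ Y.left) (X.left ◁ Y.hom)

theorem isPushout (X Y : Arrow C) :
    IsPushout (X.hom ▷ Y.left) (X.left ◁ Y.hom) (inl X Y) (inr X Y) :=
  IsPushout.of_hasPushout _ _

theorem glue (X Y : Arrow C) : X.hom ▷ Y.left ≫ inl X Y = X.left ◁ Y.hom ≫ inr X Y :=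
  (isPushout X Y).w

@[simp]
theorem inl_hom (X Y : Arrow C) : inl X Y ≫ (pp X Y).hom = X.right ◁ Y.hom :=
  pushout.inl_desc _ _ _

@[simp]
theorem inr_hom (X Y : Arrow C) : inr X Y ≫ (pp X Y).hom = X.hom ▷ Y.right :=
  pushout.inr_desc _ _ _

theorem left_ext {X Y : Arrow C} {Z : C} {f g : (pp X Y).left ⟶ Z}
    (h : inl X Y ≫ f = inl X Y ≫ g) (h' : inr X Y ≫ f = inr X Y ≫ g) : f = g :=
  (isPushout X Y).hom_ext h h'

/-- The functoriality of the pushout product in the second variable. -/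
def wl (X : Arrow C) {Y Z : Arrow C} (f : Y ⟶ Z) : pp X Y ⟶ pp X Z :=
  (Arrow.pushoutProduct.obj X).map f

/-- The functoriality of the pushout product in the first variable. -/
def wr {X Y : Arrow C} (f : X ⟶ Y) (Z : Arrow C) : pp X Z ⟶ pp Y Z :=
  (Arrow.pushoutProduct.map f).app Z

@[simp]
theorem inl_wl (X : Arrow C) {Y Z : Arrow C} (f : Y ⟶ Z) :
    inl X Y ≫ (wl X f).left = X.right ◁ f.left ≫ inl X Z :=
  IsPushout.inl_desc _ _ _ _

@[simp]
theorem inr_wl (X : Arrow C) {Y Z : Arrow C} (f : Y ⟶ Z) :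
    inr X Y ≫ (wl X f).left = X.left ◁ f.right ≫ inr X Z :=
  IsPushout.inr_desc _ _ _ _

@[simp]
theorem wl_right (X : Arrow C) {Y Z : Arrow C} (f : Y ⟶ Z) :
    (wl X f).right = X.right ◁ f.right := rfl

@[simp]
theorem inl_wr {X Y : Arrow C} (f : X ⟶ Y) (Z : Arrow C) :
    inl X Z ≫ (wr f Z).left = f.right ▷ Z.left ≫ inl Y Z :=
  IsPushout.inl_desc _ _ _ _

@[simp]
theorem inr_wr {X Y : Arrow C} (f : X ⟶ Y) (Z : Arrow C) :
    inr X Z ≫ (wr f Z).left = f.left ▷ Z.right ≫ inr Y Z :=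
  IsPushout.inr_desc _ _ _ _

@[simp]
theorem wr_right {X Y : Arrow C} (f : X ⟶ Y) (Z : Arrow C) :
    (wr f Z).right = f.right ▷ Z.right := rfl

section Assoc
variable {D : C}
@[simp]
theorem inl_wl_assoc (X : Arrow C) {Y Z : Arrow C} (f : Y ⟶ Z) (h : (pp X Z).left ⟶ D) :
    inl X Y ≫ (wl X f).left ≫ h = X.right ◁ f.left ≫ inl X Z ≫ h := by
  rw [← Category.assoc, inl_wl, Category.assoc]
@[simp]
theorem inr_wl_assoc (X : Arrow C) {Y Z : Arrow C} (f : Y ⟶ Z) (h : (pp X Z).left ⟶ D) :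
    inr X Y ≫ (wl X f).left ≫ h = X.left ◁ f.right ≫ inr X Z ≫ h := by
  rw [← Category.assoc, inr_wl, Category.assoc]
@[simp]
theorem inl_wr_assoc {X Y : Arrow C} (f : X ⟶ Y) (Z : Arrow C) (h : (pp Y Z).left ⟶ D) :
    inl X Z ≫ (wr f Z).left ≫ h = f.right ▷ Z.left ≫ inl Y Z ≫ h := by
  rw [← Category.assoc, inl_wr, Category.assoc]
@[simp]
theorem inr_wr_assoc {X Y : Arrow C} (f : X ⟶ Y) (Z : Arrow C) (h : (pp Y Z).left ⟶ D) :
    inr X Z ≫ (wr f Z).left ≫ h = f.left ▷ Z.right ≫ inr Y Z ≫ h := by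
  rw [← Category.assoc, inr_wr, Category.assoc]
end Assoc

section Whiskered
variable {D W : C}
@[simp]
theorem inl_wl_wL (X : Arrow C) {Y Z : Arrow C} (f : Y ⟶ Z) (h : W ⊗ (pp X Z).left ⟶ D) :
    W ◁ inl X Y ≫ W ◁ (wl X f).left ≫ h = W ◁ X.right ◁ f.left ≫ W ◁ inl X Z ≫ h := by
  rw [← whiskerLeft_comp_assoc, inl_wl, whiskerLeft_comp_assoc]
@[simp]
theorem inl_wl_wR (X : Arrow C) {Y Z : Arrow C} (f : Y ⟶ Z) (h : (pp X Z).left ⊗ W ⟶ D) :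
    inl X Y ▷ W ≫ (wl X f).left ▷ W ≫ h = (X.right ◁ f.left) ▷ W ≫ inl X Z ▷ W ≫ h := by
  rw [← comp_whiskerRight_assoc, inl_wl, comp_whiskerRight_assoc]
@[simp]
theorem inl_wr_wL {X Y : Arrow C} (f : X ⟶ Y) (Z : Arrow C) (h : W ⊗ (pp Y Z).left ⟶ D) :
    W ◁ inl X Z ≫ W ◁ (wr f Z).left ≫ h = W ◁ f.right ▷ Z.left ≫ W ◁ inl Y Z ≫ h := by
  rw [← whiskerLeft_comp_assoc, inl_wr, whiskerLeft_comp_assoc]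
@[simp]
theorem inl_wr_wR {X Y : Arrow C} (f : X ⟶ Y) (Z : Arrow C) (h : (pp Y Z).left ⊗ W ⟶ D) :
    inl X Z ▷ W ≫ (wr f Z).left ▷ W ≫ h = (f.right ▷ Z.left) ▷ W ≫ inl Y Z ▷ W ≫ h := by
  rw [← comp_whiskerRight_assoc, inl_wr, comp_whiskerRight_assoc]
@[simp]
theorem inr_wl_wL (X : Arrow C) {Y Z : Arrow C} (f : Y ⟶ Z) (h : W ⊗ (pp X Z).left ⟶ D) :
    W ◁ inr X Y ≫ W ◁ (wl X f).left ≫ h = W ◁ X.left ◁ f.right ≫ W ◁ inr X Z ≫ h := by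
  rw [← whiskerLeft_comp_assoc, inr_wl, whiskerLeft_comp_assoc]
@[simp]
theorem inr_wl_wR (X : Arrow C) {Y Z : Arrow C} (f : Y ⟶ Z) (h : (pp X Z).left ⊗ W ⟶ D) :
    inr X Y ▷ W ≫ (wl X f).left ▷ W ≫ h = (X.left ◁ f.right) ▷ W ≫ inr X Z ▷ W ≫ h := by
  rw [← comp_whiskerRight_assoc, inr_wl, comp_whiskerRight_assoc]
@[simp]
theorem inr_wr_wL {X Y : Arrow C} (f : X ⟶ Y) (Z : Arrow C) (h : W ⊗ (pp Y Z).left ⟶ D) :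
    W ◁ inr X Z ≫ W ◁ (wr f Z).left ≫ h = W ◁ f.left ▷ Z.right ≫ W ◁ inr Y Z ≫ h := by
  rw [← whiskerLeft_comp_assoc, inr_wr, whiskerLeft_comp_assoc]
@[simp]
theorem inr_wr_wR {X Y : Arrow C} (f : X ⟶ Y) (Z : Arrow C) (h : (pp Y Z).left ⊗ W ⟶ D) :
    inr X Z ▷ W ≫ (wr f Z).left ▷ W ≫ h = (f.left ▷ Z.right) ▷ W ≫ inr Y Z ▷ W ≫ h := by
  rw [← comp_whiskerRight_assoc, inr_wr, comp_whiskerRight_assoc]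
end Whiskered

section Braiding

/-- The braiding of the pushout product, on sources. -/
def braidLeft (X Y : Arrow C) : (pp X Y).left ⟶ (pp Y X).left :=
  (isPushout X Y).desc ((β_ _ _).hom ≫ inr Y X) ((β_ _ _).hom ≫ inl Y X) (by
    rw [BraidedCategory.braiding_naturality_left_assoc,
      BraidedCategory.braiding_naturality_right_assoc, glue])

@[simp]
theorem inl_braidLeft (X Y : Arrow C) : inl X Y ≫ braidLeft X Y = (β_ _ _).hom ≫ inr Y X :=
  IsPushout.inl_desc _ _ _ _

@[simp]
theorem inr_braidLeft (X Y : Arrow C) : inr X Y ≫ braidLeft X Y = (β_ _ _).hom ≫ inl Y X :=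
  IsPushout.inr_desc _ _ _ _

/-- The braiding of the pushout product, as a map of arrows. -/
def braidHom (X Y : Arrow C) : pp X Y ⟶ pp Y X :=
  Arrow.homMk (braidLeft X Y) (β_ _ _).hom (by
    apply left_ext <;> simp only [← Category.assoc, inl_braidLeft, inr_braidLeft, inl_hom, inr_hom] <;> simp only [Category.assoc, inl_hom, inr_hom, BraidedCategory.braiding_naturality_left, BraidedCategory.braiding_naturality_right])

end Braiding

theorem tr (X Y : Arrow C) (W : C) :
    IsPushout (X.hom ▷ Y.left ▷ W) ((X.left ◁ Y.hom) ▷ W) (inl X Y ▷ W) (inr X Y ▷ W) :=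
  (isPushout X Y).map (tensorRight W)

theorem tl (X Y : Arrow C) (W : C) : IsPushout (W ◁ X.hom ▷ Y.left) (W ◁ X.left ◁ Y.hom) (W ◁ inl X Y) (W ◁ inr X Y) :=
  (isPushout X Y).map (tensorLeft W)

/-- The associator of the pushout product, on sources. -/
def assocLeft (X Y Z : Arrow C) : (pp (pp X Y) Z).left ⟶ (pp X (pp Y Z)).left :=
  (isPushout (pp X Y) Z).desc ((α_ _ _ _).hom ≫ X.right ◁ inl Y Z ≫ inl X (pp Y Z))
    ((tr X Y Z.right).desc ((α_ _ _ _).hom ≫ X.right ◁ inr Y Z ≫ inl X (pp Y Z))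
        ((α_ _ _ _).hom ≫ inr X (pp Y Z)) (by
        have h1 := inr_hom Y Z
        have h2 := glue X (pp Y Z)
        rw [associator_naturality_left_assoc, ← whisker_exchange_assoc, h2, ← whiskerLeft_comp_assoc, h1, associator_naturality_middle_assoc])) (by
    apply (tr X Y Z.left).hom_ext
    · rw [← comp_whiskerRight_assoc, inl_hom, ← whisker_exchange_assoc, IsPushout.inl_desc]
      simp
      simp only [← whiskerLeft_comp_assoc, glue]
    · rw [← comp_whiskerRight_assoc, inr_hom, ← whisker_exchange_assoc, IsPushout.inr_desc]
      have h1 := inl_hom Y Z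
      have h2 := glue X (pp Y Z)
      rw [associator_naturality_left_assoc, ← whisker_exchange_assoc, h2, ← whiskerLeft_comp_assoc, h1, associator_naturality_right_assoc])

@[simp] theorem assocLeft₁ (X Y Z : Arrow C) : inl (pp X Y) Z ≫ assocLeft X Y Z = (α_ _ _ _).hom ≫ X.right ◁ inl Y Z ≫ inl X (pp Y Z) := IsPushout.inl_desc _ _ _ _
@[simp] theorem assocLeft₂ (X Y Z : Arrow C) : inl X Y ▷ Z.right ≫ inr (pp X Y) Z ≫ assocLeft X Y Z = (α_ _ _ _).hom ≫ X.right ◁ inr Y Z ≫ inl X (pp Y Z) := by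
  rw [assocLeft, IsPushout.inr_desc, IsPushout.inl_desc]
@[simp] theorem assocLeft₃ (X Y Z : Arrow C) : inr X Y ▷ Z.right ≫ inr (pp X Y) Z ≫ assocLeft X Y Z = (α_ _ _ _).hom ≫ inr X (pp Y Z) := by
  rw [assocLeft, IsPushout.inr_desc, IsPushout.inr_desc]

theorem left_ext₃ {X Y Z : Arrow C} {D : C} {f g : (pp (pp X Y) Z).left ⟶ D} 
   (h₁ : inl (pp X Y) Z ≫ f = inl (pp X Y) Z ≫ g)
   (h₂ : inl X Y ▷ Z.right ≫ inr (pp X Y) Z ≫ f = inl X Y ▷ Z.right ≫ inr (pp X Y) Z ≫ g)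
   (h₃ : inr X Y ▷ Z.right ≫ inr (pp X Y) Z ≫ f = inr X Y ▷ Z.right ≫ inr (pp X Y) Z ≫ g) : f = g :=
  left_ext h₁ ((tr X Y Z.right).hom_ext h₂ h₃)

theorem left_ext₃' {X Y Z : Arrow C} {D : C} {f g : (pp X (pp Y Z)).left ⟶ D} 
   (h₁ : X.right ◁ inl Y Z ≫ inl X (pp Y Z) ≫ f = X.right ◁ inl Y Z ≫ inl X (pp Y Z) ≫ g)
   (h₂ : X.right ◁ inr Y Z ≫ inl X (pp Y Z) ≫ f = X.right ◁ inr Y Z ≫ inl X (pp Y Z) ≫ g)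
   (h₃ : inr X (pp Y Z) ≫ f = inr X (pp Y Z) ≫ g) : f = g :=
  left_ext ((tl Y Z X.right).hom_ext h₁ h₂) h₃

/-- The inverse associator of the pushout product, on sources. -/
def assocInvLeft (X Y Z : Arrow C) : (pp X (pp Y Z)).left ⟶ (pp (pp X Y) Z).left :=
  (isPushout X (pp Y Z)).desc
    ((tl Y Z X.right).desc ((α_ _ _ _).inv ≫ inl (pp X Y) Z)
        ((α_ _ _ _).inv ≫ inl X Y ▷ Z.right ≫ inr (pp X Y) Z) (by
        have h1 := inl_hom X Y
        have h2 := glue (pp X Y) Z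
        rw [associator_inv_naturality_right_assoc, whisker_exchange_assoc, ← h2, ← comp_whiskerRight_assoc, h1, associator_inv_naturality_middle_assoc])) 
    ((α_ _ _ _).inv ≫ inr X Y ▷ Z.right ≫ inr (pp X Y) Z) (by
    apply (tl Y Z X.left).hom_ext
    · rw [← whiskerLeft_comp_assoc, inl_hom Y Z, whisker_exchange_assoc, IsPushout.inl_desc]
      have h1 := inr_hom X Y
      have h2 := glue (pp X Y) Z
      rw [associator_inv_naturality_right_assoc, whisker_exchange_assoc, ← h2, ← comp_whiskerRight_assoc, h1, associator_inv_naturality_left_assoc]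
    · rw [← whiskerLeft_comp_assoc, inr_hom Y Z, whisker_exchange_assoc, IsPushout.inr_desc]
      rw [associator_inv_naturality_left_assoc, ← comp_whiskerRight_assoc, glue, comp_whiskerRight_assoc,
        associator_inv_naturality_middle_assoc])

@[simp] theorem assocInvLeft₁ (X Y Z : Arrow C) : X.right ◁ inl Y Z ≫ inl X (pp Y Z) ≫ assocInvLeft X Y Z = (α_ _ _ _).inv ≫ inl (pp X Y) Z := by
  rw [assocInvLeft, IsPushout.inl_desc, IsPushout.inl_desc]
@[simp] theorem assocInvLeft₂ (X Y Z : Arrow C) : X.right ◁ inr Y Z ≫ inl X (pp Y Z) ≫ assocInvLeft X Y Z = (α_ _ _ _).inv ≫ inl X Y ▷ Z.right ≫ inr (pp X Y) Z := by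
  rw [assocInvLeft, IsPushout.inl_desc, IsPushout.inr_desc]
@[simp] theorem assocInvLeft₃ (X Y Z : Arrow C) : inr X (pp Y Z) ≫ assocInvLeft X Y Z = (α_ _ _ _).inv ≫ inr X Y ▷ Z.right ≫ inr (pp X Y) Z := IsPushout.inr_desc _ _ _ _

variable {D : C}
@[simp] theorem assocInvLeft₁_assoc (X Y Z : Arrow C) (h : _ ⟶ D) : X.right ◁ inl Y Z ≫ inl X (pp Y Z) ≫ assocInvLeft X Y Z ≫ h = (α_ _ _ _).inv ≫ inl (pp X Y) Z ≫ h := by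
  have := congrArg (· ≫ h) (assocInvLeft₁ X Y Z)
  simpa only [Category.assoc] using this
@[simp] theorem assocInvLeft₂_assoc (X Y Z : Arrow C) (h : _ ⟶ D) : X.right ◁ inr Y Z ≫ inl X (pp Y Z) ≫ assocInvLeft X Y Z ≫ h = (α_ _ _ _).inv ≫ inl X Y ▷ Z.right ≫ inr (pp X Y) Z ≫ h := by
  have := congrArg (· ≫ h) (assocInvLeft₂ X Y Z)
  simpa only [Category.assoc] using this
@[simp] theorem assocInvLeft₃_assoc (X Y Z : Arrow C) (h : _ ⟶ D) : inr X (pp Y Z) ≫ assocInvLeft X Y Z ≫ h = (α_ _ _ _).inv ≫ inr X Y ▷ Z.right ≫ inr (pp X Y) Z ≫ h := by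
  have := congrArg (· ≫ h) (assocInvLeft₃ X Y Z)
  simpa only [Category.assoc] using this
@[simp] theorem assocLeft₁_assoc (X Y Z : Arrow C) (h : _ ⟶ D) : inl (pp X Y) Z ≫ assocLeft X Y Z ≫ h = (α_ _ _ _).hom ≫ X.right ◁ inl Y Z ≫ inl X (pp Y Z) ≫ h := by
  rw [← Category.assoc, assocLeft₁]; simp only [Category.assoc]
@[simp] theorem assocLeft₂_assoc (X Y Z : Arrow C) (h : _ ⟶ D) : inl X Y ▷ Z.right ≫ inr (pp X Y) Z ≫ assocLeft X Y Z ≫ h = (α_ _ _ _).hom ≫ X.right ◁ inr Y Z ≫ inl X (pp Y Z) ≫ h := by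
  have := congrArg (· ≫ h) (assocLeft₂ X Y Z)
  simpa only [Category.assoc] using this
@[simp] theorem assocLeft₃_assoc (X Y Z : Arrow C) (h : _ ⟶ D) : inr X Y ▷ Z.right ≫ inr (pp X Y) Z ≫ assocLeft X Y Z ≫ h = (α_ _ _ _).hom ≫ inr X (pp Y Z) ≫ h := by
  have := congrArg (· ≫ h) (assocLeft₃ X Y Z)
  simpa only [Category.assoc] using this

/-- The associator of the pushout product. -/
def assocIso (X Y Z : Arrow C) : pp (pp X Y) Z ≅ pp X (pp Y Z) :=
  Arrow.isoMk ⟨assocLeft X Y Z, assocInvLeft X Y Z, by apply left_ext₃ <;> simp, by apply left_ext₃' <;> simp⟩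
    (α_ _ _ _) (by
      have e1 := inl_hom X (pp Y Z)
      have e2 := inr_hom X (pp Y Z)
      have e3 := inl_hom (pp X Y) Z
      have e4 := inr_hom (pp X Y) Z
      have e5 := inl_hom X Y
      have e6 := inr_hom X Y
      have e7 := inl_hom Y Z
      have e8 := inr_hom Y Z
      apply left_ext₃
      · dsimp only
        rw [assocLeft₁_assoc, e1, ← Category.assoc (inl _ _), e3, ← whiskerLeft_comp, e7]
        exact (associator_naturality_right _ _ _).symm
      · dsimp only
        rw [assocLeft₂_assoc, e1, ← Category.assoc (inr _ _), e4, ← whiskerLeft_comp, e8, ← comp_whiskerRight_assoc, e5]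
        exact (associator_naturality_middle _ _ _).symm
      · dsimp only
        rw [assocLeft₃_assoc, e2, ← Category.assoc (inr _ _), e4, ← comp_whiskerRight_assoc, e6]
        exact (associator_naturality_left _ _ _).symm)

@[simp] theorem assocIso_hom_left (X Y Z : Arrow C) : (assocIso X Y Z).hom.left = assocLeft X Y Z := rfl
@[simp] theorem assocIso_hom_right (X Y Z : Arrow C) : (assocIso X Y Z).hom.right = (α_ X.right Y.right Z.right).hom := rfl
@[simp] theorem assocIso_inv_left (X Y Z : Arrow C) : (assocIso X Y Z).inv.left = assocInvLeft X Y Z := rfl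
@[simp] theorem assocIso_inv_right (X Y Z : Arrow C) : (assocIso X Y Z).inv.right = (α_ X.right Y.right Z.right).inv := rfl

@[simp]
theorem inl_braidLeft_assoc (X Y : Arrow C) (h : _ ⟶ D) : inl X Y ≫ braidLeft X Y ≫ h = (β_ _ _).hom ≫ inr Y X ≫ h := by
  rw [← Category.assoc, inl_braidLeft, Category.assoc]

@[simp]
theorem inr_braidLeft_assoc (X Y : Arrow C) (h : _ ⟶ D) : inr X Y ≫ braidLeft X Y ≫ h = (β_ _ _).hom ≫ inl Y X ≫ h := by
  rw [← Category.assoc, inr_braidLeft, Category.assoc]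

@[simp]
theorem braid_braid (X Y : Arrow C) : braidLeft X Y ≫ braidLeft Y X = 𝟙 _ := by
  apply left_ext
  · rw [← Category.assoc, inl_braidLeft]; simp
  · rw [← Category.assoc, inr_braidLeft]; simp

/-- The braiding of the pushout product. -/
def braidIso (X Y : Arrow C) : pp X Y ≅ pp Y X where
  hom := braidHom X Y
  inv := braidHom Y X
  hom_inv_id := Arrow.hom_ext _ _ (braid_braid X Y) (by simp [braidHom])
  inv_hom_id := Arrow.hom_ext _ _ (braid_braid Y X) (by simp [braidHom])

@[simp] theorem braidIso_hom_left (X Y : Arrow C) : (braidIso X Y).hom.left = braidLeft X Y := rfl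
@[simp] theorem braidIso_hom_right (X Y : Arrow C) : (braidIso X Y).hom.right = (β_ X.right Y.right).hom := rfl
@[simp] theorem braidIso_inv_left (X Y : Arrow C) : (braidIso X Y).inv.left = braidLeft Y X := rfl
@[simp] theorem braidIso_inv_right (X Y : Arrow C) : (braidIso X Y).inv.right = (β_ Y.right X.right).hom := rfl

/-- The monoidal unit `∅ ⟶ 𝟙`. -/
abbrev unitArrow : Arrow C := Arrow.mk (initial.to (𝟙_ C))

/-- Tensoring with `A` preserves the initial object. -/
def isInitialTensor (A : C) : IsInitial (A ⊗ ⊥_ C) :=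
  initialIsInitial.isInitialObj (tensorLeft A) _

/-- Tensoring with `A` preserves the initial object. -/
def isInitialTensor' (A : C) : IsInitial ((⊥_ C) ⊗ A) :=
  initialIsInitial.isInitialObj (tensorRight A) _

/-- The right unitor of the pushout product, on sources. -/
def rightUnitLeft (X : Arrow C) : (pp X unitArrow).left ⟶ X.left :=
  (isPushout X unitArrow).desc ((isInitialTensor X.right).to _) (ρ_ X.left).hom ((isInitialTensor X.left).hom_ext _ _)

@[simp]
theorem inr_rightUnitLeft (X : Arrow C) : inr X unitArrow ≫ rightUnitLeft X = (ρ_ X.left).hom :=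
  IsPushout.inr_desc _ _ _ _

theorem left_ext_unit {X : Arrow C} {Z : C} {f g : (pp X unitArrow).left ⟶ Z}
    (h' : inr X unitArrow ≫ f = inr X unitArrow ≫ g) : f = g :=
  left_ext ((isInitialTensor X.right).hom_ext _ _) h'

/-- The right unitor of the pushout product. -/
def rightUnitIso (X : Arrow C) : pp X unitArrow ≅ X :=
  Arrow.isoMk ⟨rightUnitLeft X, (ρ_ X.left).inv ≫ inr X unitArrow, by apply left_ext_unit; rw [← Category.assoc, inr_rightUnitLeft]; simp, by simp⟩
   (ρ_ X.right) (by
     apply left_ext_unit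
     have e := inr_hom X unitArrow
     dsimp only
     rw [← Category.assoc, inr_rightUnitLeft, ← Category.assoc, e]
     exact (rightUnitor_naturality _).symm)
  
/-- The left unitor of the pushout product, on sources. -/
def leftUnitLeft (X : Arrow C) : (pp unitArrow X).left ⟶ X.left :=
  (isPushout unitArrow X).desc (λ_ X.left).hom ((isInitialTensor' X.right).to _)  ((isInitialTensor' X.left).hom_ext _ _)

@[simp]
theorem inl_leftUnitLeft (X : Arrow C) : inl unitArrow X ≫ leftUnitLeft X = (λ_ X.left).hom :=
  IsPushout.inl_desc _ _ _ _

theorem left_ext_unit' {X : Arrow C} {Z : C} {f g : (pp unitArrow X).left ⟶ Z}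
    (h' : inl unitArrow X ≫ f = inl unitArrow X ≫ g) : f = g :=
  left_ext h' ((isInitialTensor' X.right).hom_ext _ _)

/-- The left unitor of the pushout product. -/
def leftUnitIso (X : Arrow C) : pp unitArrow X ≅ X :=
  Arrow.isoMk ⟨leftUnitLeft X, (λ_ X.left).inv ≫ inl unitArrow X, by apply left_ext_unit'; rw [← Category.assoc, inl_leftUnitLeft]; simp, by simp⟩
   (λ_ X.right) (by
     apply left_ext_unit'
     have e := inl_hom unitArrow X
     dsimp only
     rw [← Category.assoc, inl_leftUnitLeft, ← Category.assoc, e]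
     exact (leftUnitor_naturality _).symm)

@[simp] theorem rightUnitIso_hom_left (X : Arrow C) : (rightUnitIso X).hom.left = rightUnitLeft X := rfl
@[simp] theorem rightUnitIso_hom_right (X : Arrow C) : (rightUnitIso X).hom.right = (ρ_ X.right).hom := rfl
@[simp] theorem leftUnitIso_hom_left (X : Arrow C) : (leftUnitIso X).hom.left = leftUnitLeft X := rfl
@[simp] theorem leftUnitIso_hom_right (X : Arrow C) : (leftUnitIso X).hom.right = (λ_ X.right).hom := rfl

/-- The tensor product of two arrows is their pushout product, and the unit is `∅ ⟶ 𝟙`. -/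
instance instMonoidalStruct : MonoidalCategoryStruct (Arrow C) where
  tensorObj := pp
  whiskerLeft X _ _ f := wl X f
  whiskerRight f X := wr f X
  tensorUnit := unitArrow
  associator := assocIso
  leftUnitor := leftUnitIso
  rightUnitor := rightUnitIso

theorem wl_id (X Y : Arrow C) : wl X (𝟙 Y) = 𝟙 (pp X Y) := (Arrow.pushoutProduct.obj X).map_id _
theorem wr_id (X Y : Arrow C) : wr (𝟙 X) Y = 𝟙 (pp X Y) := by
  apply Arrow.hom_ext
  · apply left_ext <;> simp
  · simp
theorem wl_comp (W : Arrow C) {X Y Z : Arrow C} (f : X ⟶ Y) (g : Y ⟶ Z) : wl W (f ≫ g) = wl W f ≫ wl W g := (Arrow.pushoutProduct.obj W).map_comp _ _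
theorem wr_comp (W : Arrow C) {X Y Z : Arrow C} (f : X ⟶ Y) (g : Y ⟶ Z) : wr (f ≫ g) W = wr f W ≫ wr g W := by
  apply Arrow.hom_ext
  · apply left_ext <;> simp
  · simp
@[simp] theorem inr_rightUnitLeft_assoc (X : Arrow C) (h : _ ⟶ D) : inr X unitArrow ≫ rightUnitLeft X ≫ h = (ρ_ X.left).hom ≫ h := by
  rw [← Category.assoc, inr_rightUnitLeft]
@[simp] theorem inl_leftUnitLeft_assoc (X : Arrow C) (h : _ ⟶ D) : inl unitArrow X ≫ leftUnitLeft X ≫ h = (λ_ X.left).hom ≫ h := by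
  rw [← Category.assoc, inl_leftUnitLeft]
theorem wl_unit {X Y : Arrow C} (f : X ⟶ Y) : wl unitArrow f ≫ (leftUnitIso Y).hom = (leftUnitIso X).hom ≫ f := by
  apply Arrow.hom_ext
  · apply left_ext_unit'
    simp
  · simp
theorem wr_unit {X Y : Arrow C} (f : X ⟶ Y) : wr f unitArrow ≫ (rightUnitIso Y).hom = (rightUnitIso X).hom ≫ f := by
  apply Arrow.hom_ext
  · apply left_ext_unit
    simp
  · simp
theorem wl_wl (X Y : Arrow C) {Z W : Arrow C} (f : Z ⟶ W) : wl (pp X Y) f ≫ (assocIso X Y W).hom = (assocIso X Y Z).hom ≫ wl X (wl Y f) := by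
  apply Arrow.hom_ext
  · apply left_ext₃
    · simp
    · simp [← whisker_exchange_assoc]
    · simp [← whisker_exchange_assoc]
  · simp
theorem wl_wr (X Y : Arrow C) {Z W : Arrow C} (f : Z ⟶ W) : wr (wl X f) Y ≫ (assocIso X W Y).hom = (assocIso X Z Y).hom ≫ wl X (wr f Y) := by
  apply Arrow.hom_ext
  · apply left_ext₃
    · simp
    · simp 
    · simp
  · simp
theorem wr_wr (X Y : Arrow C) {Z W : Arrow C} (f : Z ⟶ W) : wr (wr f X) Y ≫ (assocIso W X Y).hom = (assocIso Z X Y).hom ≫ wr f (pp X Y) := by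
  apply Arrow.hom_ext
  · apply left_ext₃
    · simp [whisker_exchange_assoc]
    · simp [whisker_exchange_assoc]
    · simp
  · simp

theorem exch {W X Y Z : Arrow C} (f : W ⟶ X) (g : Y ⟶ Z) : wl W g ≫ wr f Z = wr f Y ≫ wl X g := by
  apply Arrow.hom_ext
  · apply left_ext
    · simp [whisker_exchange_assoc]
    · simp [whisker_exchange_assoc]
  · simp [whisker_exchange]

section Whiskered
variable {W : C}
@[simp]
theorem assocLeft₁_wL (X Y Z : Arrow C) (h : W ⊗ (pp X (pp Y Z)).left ⟶ D) :
    W ◁ (inl (pp X Y) Z) ≫ W ◁ (assocLeft X Y Z) ≫ h =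
      W ◁ ((α_ X.right Y.right Z.left).hom) ≫ W ◁ (X.right ◁ inl Y Z) ≫ W ◁ (inl X (pp Y Z)) ≫ h := by
  have := congrArg (fun t ↦ W ◁ t ≫ h) (assocLeft₁ X Y Z)
  simpa only [MonoidalCategory.whiskerLeft_comp, comp_whiskerRight, Category.assoc] using this
@[simp]
theorem assocLeft₁_wR (X Y Z : Arrow C) (h : (pp X (pp Y Z)).left ⊗ W ⟶ D) :
    (inl (pp X Y) Z) ▷ W ≫ (assocLeft X Y Z) ▷ W ≫ h =
      ((α_ X.right Y.right Z.left).hom) ▷ W ≫ (X.right ◁ inl Y Z) ▷ W ≫ (inl X (pp Y Z)) ▷ W ≫ h := by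
  have := congrArg (fun t ↦ t ▷ W ≫ h) (assocLeft₁ X Y Z)
  simpa only [MonoidalCategory.whiskerLeft_comp, comp_whiskerRight, Category.assoc] using this
@[simp]
theorem assocLeft₂_wL (X Y Z : Arrow C) (h : W ⊗ (pp X (pp Y Z)).left ⟶ D) :
    W ◁ (inl X Y ▷ Z.right) ≫ W ◁ (inr (pp X Y) Z) ≫ W ◁ (assocLeft X Y Z) ≫ h =
      W ◁ ((α_ X.right Y.left Z.right).hom) ≫ W ◁ (X.right ◁ inr Y Z) ≫ W ◁ (inl X (pp Y Z)) ≫ h := by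
  have := congrArg (fun t ↦ W ◁ t ≫ h) (assocLeft₂ X Y Z)
  simpa only [MonoidalCategory.whiskerLeft_comp, comp_whiskerRight, Category.assoc] using this
@[simp]
theorem assocLeft₂_wR (X Y Z : Arrow C) (h : (pp X (pp Y Z)).left ⊗ W ⟶ D) :
    (inl X Y ▷ Z.right) ▷ W ≫ (inr (pp X Y) Z) ▷ W ≫ (assocLeft X Y Z) ▷ W ≫ h =
      ((α_ X.right Y.left Z.right).hom) ▷ W ≫ (X.right ◁ inr Y Z) ▷ W ≫ (inl X (pp Y Z)) ▷ W ≫ h := by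
  have := congrArg (fun t ↦ t ▷ W ≫ h) (assocLeft₂ X Y Z)
  simpa only [MonoidalCategory.whiskerLeft_comp, comp_whiskerRight, Category.assoc] using this
@[simp]
theorem assocLeft₃_wL (X Y Z : Arrow C) (h : W ⊗ (pp X (pp Y Z)).left ⟶ D) :
    W ◁ (inr X Y ▷ Z.right) ≫ W ◁ (inr (pp X Y) Z) ≫ W ◁ (assocLeft X Y Z) ≫ h =
      W ◁ ((α_ X.left Y.right Z.right).hom) ≫ W ◁ (inr X (pp Y Z)) ≫ h := by
  have := congrArg (fun t ↦ W ◁ t ≫ h) (assocLeft₃ X Y Z)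
  simpa only [MonoidalCategory.whiskerLeft_comp, comp_whiskerRight, Category.assoc] using this
@[simp]
theorem assocLeft₃_wR (X Y Z : Arrow C) (h : (pp X (pp Y Z)).left ⊗ W ⟶ D) :
    (inr X Y ▷ Z.right) ▷ W ≫ (inr (pp X Y) Z) ▷ W ≫ (assocLeft X Y Z) ▷ W ≫ h =
      ((α_ X.left Y.right Z.right).hom) ▷ W ≫ (inr X (pp Y Z)) ▷ W ≫ h := by
  have := congrArg (fun t ↦ t ▷ W ≫ h) (assocLeft₃ X Y Z)
  simpa only [MonoidalCategory.whiskerLeft_comp, comp_whiskerRight, Category.assoc] using this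
@[simp]
theorem inl_braidLeft_wL (X Y : Arrow C) (h : W ⊗ (pp Y X).left ⟶ D) :
    W ◁ (inl X Y) ≫ W ◁ (braidLeft X Y) ≫ h =
      W ◁ ((β_ X.right Y.left).hom) ≫ W ◁ (inr Y X) ≫ h := by
  have := congrArg (fun t ↦ W ◁ t ≫ h) (inl_braidLeft X Y)
  simpa only [MonoidalCategory.whiskerLeft_comp, comp_whiskerRight, Category.assoc] using this
@[simp]
theorem inl_braidLeft_wR (X Y : Arrow C) (h : (pp Y X).left ⊗ W ⟶ D) :
    (inl X Y) ▷ W ≫ (braidLeft X Y) ▷ W ≫ h =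
      ((β_ X.right Y.left).hom) ▷ W ≫ (inr Y X) ▷ W ≫ h := by
  have := congrArg (fun t ↦ t ▷ W ≫ h) (inl_braidLeft X Y)
  simpa only [MonoidalCategory.whiskerLeft_comp, comp_whiskerRight, Category.assoc] using this
@[simp]
theorem inr_braidLeft_wL (X Y : Arrow C) (h : W ⊗ (pp Y X).left ⟶ D) :
    W ◁ (inr X Y) ≫ W ◁ (braidLeft X Y) ≫ h =
      W ◁ ((β_ X.left Y.right).hom) ≫ W ◁ (inl Y X) ≫ h := by
  have := congrArg (fun t ↦ W ◁ t ≫ h) (inr_braidLeft X Y)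
  simpa only [MonoidalCategory.whiskerLeft_comp, comp_whiskerRight, Category.assoc] using this
@[simp]
theorem inr_braidLeft_wR (X Y : Arrow C) (h : (pp Y X).left ⊗ W ⟶ D) :
    (inr X Y) ▷ W ≫ (braidLeft X Y) ▷ W ≫ h =
      ((β_ X.left Y.right).hom) ▷ W ≫ (inl Y X) ▷ W ≫ h := by
  have := congrArg (fun t ↦ t ▷ W ≫ h) (inr_braidLeft X Y)
  simpa only [MonoidalCategory.whiskerLeft_comp, comp_whiskerRight, Category.assoc] using this
end Whiskered

theorem pentagon' (W X Y Z : Arrow C) :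
    wr (assocIso W X Y).hom Z ≫ (assocIso W (pp X Y) Z).hom ≫ wl W (assocIso X Y Z).hom =
      (assocIso (pp W X) Y Z).hom ≫ (assocIso W X (pp Y Z)).hom := by
  apply Arrow.hom_ext
  · apply left_ext₃
    · simp
    · simp
    · apply (((isPushout W X).map (tensorRight Y.right)).map (tensorRight Z.right)).hom_ext
      · simp
        refine Eq.trans ?_ (associator_naturality_left_assoc _ _ _ _).symm
        have e := assocLeft₂ W X (pp Y Z)
        have e' := congrArg (fun t ↦ (α_ _ Y.right Z.right).hom ≫ t) e
        refine Eq.trans ?_ e'.symm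
        simp
      · simp
        refine Eq.trans ?_ (associator_naturality_left_assoc _ _ _ _).symm
        have e := assocLeft₃ W X (pp Y Z)
        have e' := congrArg (fun t ↦ (α_ _ Y.right Z.right).hom ≫ t) e
        refine Eq.trans ?_ e'.symm
        simp
  · simp

theorem triangle' (X Y : Arrow C) :
    (assocIso X unitArrow Y).hom ≫ wl X (leftUnitIso Y).hom = wr (rightUnitIso X).hom Y := by
  apply Arrow.hom_ext
  · apply left_ext₃
    · simp [← whiskerLeft_comp_assoc]
    · exact (((isInitialTensor X.right).isInitialObj (tensorRight Y.right) _)).hom_ext _ _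
    · simp [← comp_whiskerRight_assoc]
  · simp

theorem hex1 (X Y Z : Arrow C) :
   (assocIso X Y Z).hom ≫ (braidIso X (pp Y Z)).hom ≫ (assocIso Y Z X).hom =
     wr (braidIso X Y).hom Z ≫ (assocIso Y X Z).hom ≫ wl Y (braidIso X Z).hom := by
  apply Arrow.hom_ext
  · apply left_ext₃
    · simp
    · simp
    · simp
  · simp
theorem hex2 (X Y Z : Arrow C) :
   (assocIso X Y Z).inv ≫ (braidIso (pp X Y) Z).hom ≫ (assocIso Z X Y).inv =
     wl X (braidIso Y Z).hom ≫ (assocIso X Z Y).inv ≫ wr (braidIso X Z).hom Y := by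
  apply Arrow.hom_ext
  · apply left_ext₃'
    · simp
    · simp
    · simp
  · simp
theorem braid_wl (X : Arrow C) {Y Z : Arrow C} (f : Y ⟶ Z) : wl X f ≫ (braidIso X Z).hom = (braidIso X Y).hom ≫ wr f X := by
  apply Arrow.hom_ext
  · apply left_ext
    · simp
    · simp
  · simp
theorem braid_wr (X : Arrow C) {Y Z : Arrow C} (f : Y ⟶ Z) : wr f X ≫ (braidIso Z X).hom = (braidIso Y X).hom ≫ wl X f := by
  apply Arrow.hom_ext
  · apply left_ext
    · simp
    · simp
  · simp

/-- The pushout product monoidal structure on the arrow category. -/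
instance instMonoidal : MonoidalCategory (Arrow C) where
  tensorHom_def _ _ := rfl
  id_tensorHom_id X Y := by
    change wr (𝟙 X) Y ≫ wl X (𝟙 Y) = 𝟙 (pp X Y)
    rw [wr_id, wl_id, Category.comp_id]
  tensorHom_comp_tensorHom {X₁ Y₁ Z₁ X₂ Y₂ Z₂} f₁ f₂ g₁ g₂ := by
    change (wr f₁ X₂ ≫ wl Y₁ f₂) ≫ (wr g₁ Y₂ ≫ wl Z₁ g₂) = wr (f₁ ≫ g₁) X₂ ≫ wl Z₁ (f₂ ≫ g₂)
    rw [wr_comp, wl_comp, Category.assoc, Category.assoc, ← Category.assoc (wl Y₁ f₂), exch, Category.assoc]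
  whiskerLeft_id X Y := wl_id X Y
  id_whiskerRight X Y := wr_id X Y
  associator_naturality {X₁ X₂ X₃ Y₁ Y₂ Y₃} f₁ f₂ f₃ := by
    change (wr (wr f₁ X₂ ≫ wl Y₁ f₂) X₃ ≫ wl (pp Y₁ Y₂) f₃) ≫ (assocIso Y₁ Y₂ Y₃).hom =
      (assocIso X₁ X₂ X₃).hom ≫ wr f₁ (pp X₂ X₃) ≫ wl Y₁ (wr f₂ X₃ ≫ wl Y₂ f₃)
    rw [wr_comp, wl_comp, Category.assoc, Category.assoc, wl_wl, ← Category.assoc (wr (wl _ _) _), wl_wr,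
      Category.assoc, ← Category.assoc (wr (wr _ _) _), wr_wr, Category.assoc]
  leftUnitor_naturality f := wl_unit f
  rightUnitor_naturality f := wr_unit f
  pentagon := pentagon'
  triangle := triangle'

/-- The pushout product monoidal structure is symmetric. -/
instance instSymmetric : SymmetricCategory (Arrow C) where
  braiding := braidIso
  braiding_naturality_right X _ _ f := braid_wl X f
  braiding_naturality_left f X := braid_wr X f
  hexagon_forward := hex1
  hexagon_reverse := hex2
  symmetry X Y := (braidIso X Y).hom_inv_id

/-- The pushout product monoidal structure is closed; its internal hom is the pullback-hom. -/
instance instClosed [HasPullbacks C] : MonoidalClosed (Arrow C) where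
  closed X := {
    rightAdj := Arrow.pullbackHom.obj (Opposite.op X)
    adj := Functor.LeibnizAdjunction.adj _ _ MonoidalClosed.internalHomAdjunction₂ X }

theorem tensorObj_eq (X Y : Arrow C) : X ⊗ Y = (Arrow.pushoutProduct.obj X).obj Y := rfl

theorem tensorUnit_eq : 𝟙_ (Arrow C) = Arrow.mk (initial.to (𝟙_ C)) := rfl

end
end PushoutProductMonoidal

/-! ## Monoidal model categories -/

/-- A monoidal model category: a bicomplete symmetric monoidal closed category with a model
structure satisfying the pushout product axiom. No axiom on the monoidal unit is imposed. -/
class MonoidalModelCategory (C : Type u) [Category.{v} C] [HasLimits C] [HasColimits C]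
    [MonoidalCategory C] [SymmetricCategory C] [MonoidalClosed C] extends ModelCategory C where
  cofibration_pushoutProduct {X₀ X₁ Y₀ Y₁ : C} (f : X₀ ⟶ X₁) (g : Y₀ ⟶ Y₁) :
    Cofibration f → Cofibration g →
      Cofibration ((Arrow.pushoutProduct.obj (Arrow.mk f)).obj (Arrow.mk g)).hom
  weakEquivalence_pushoutProduct {X₀ X₁ Y₀ Y₁ : C} (f : X₀ ⟶ X₁) (g : Y₀ ⟶ Y₁) :
    Cofibration f → Cofibration g → (WeakEquivalence f ∨ WeakEquivalence g) →
      WeakEquivalence ((Arrow.pushoutProduct.obj (Arrow.mk f)).obj (Arrow.mk g)).hom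

/-- The two factorizations of a model category can be chosen functorially. -/
structure HasFunctorialModelFactorizations (C : Type u) [Category.{v} C] [ModelCategory C] :
    Prop where
  trivialCofibration_fibration :
    (trivialCofibrations C).HasFunctorialFactorization (fibrations C)
  cofibration_trivialFibration :
    (cofibrations C).HasFunctorialFactorization (trivialFibrations C)

/-! ## Cubical diagrams -/

/-- Bundled bicomplete symmetric monoidal closed categories. -/
structure BicompleteSMCC : Type (max (u + 1) (v + 1)) where
  carrier : Type u
  [category : Category.{v} carrier]
  [hasLimits : HasLimits carrier]
  [hasColimits : HasColimits carrier]
  [monoidal : MonoidalCategory carrier]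
  [symmetric : SymmetricCategory carrier]
  [closed : MonoidalClosed carrier]

namespace BicompleteSMCC

attribute [instance] category hasLimits hasColimits monoidal symmetric closed

/-- The arrow category with the pushout product monoidal structure. -/
noncomputable def arrow (M : BicompleteSMCC.{v, u}) : BicompleteSMCC.{v, max u v} where
  carrier := Arrow M.carrier
  category := inferInstance
  hasLimits := inferInstance
  hasColimits := inferInstance
  monoidal := PushoutProductMonoidal.instMonoidal
  symmetric := PushoutProductMonoidal.instSymmetric
  closed := PushoutProductMonoidal.instClosed

/-- The category of commutative `n`-cubes in `M`, as the `n`-fold iterated arrow category, with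
the iterated pushout product monoidal structure. -/
noncomputable def cube (M : BicompleteSMCC.{v, max u v}) : ℕ → BicompleteSMCC.{v, max u v}
  | 0 => M
  | n + 1 => arrow.{v, max u v} (cube M n)

end BicompleteSMCC

/-- Evaluation of arrows at the source (`0`) and at the target (`1`). -/
def arrowEv (C : Type u) [Category.{v} C] : Fin 2 → (Arrow C ⥤ C)
  | 0 => Arrow.leftFunc
  | 1 => Arrow.rightFunc

section Cube

variable (M : Type (max u v)) [Category.{v} M] [HasLimits M] [HasColimits M]
  [MonoidalCategory M] [SymmetricCategory M] [MonoidalClosed M]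

/-- The category of commutative `n`-cubes in `M`: `Cube M 0` is `M`, and `Cube M (n + 1)` is the
arrow category of `Cube M n`, with the pushout product monoidal structure. -/
noncomputable abbrev Cube (n : ℕ) : Type (max u v) :=
  (BicompleteSMCC.cube.{v, u} (BicompleteSMCC.mk.{v, max u v} M) n).carrier

/-- Evaluation of commutative `n`-cubes at a vertex of `{0, 1}ⁿ`. -/
noncomputable def Cube.ev : (n : ℕ) → (Fin n → Fin 2) → Cube.{v, u} M n ⥤ M
  | 0, _ => 𝟭 M
  | n + 1, ε =>
    arrowEv (Cube.{v, u} M n) (ε 0) ⋙ Cube.ev n (Fin.tail ε)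

/-- A model structure on the category of `n`-cubes in `M` is projective if weak equivalences and
fibrations are defined vertexwise in `M`. -/
structure Cube.IsProjective [ModelCategory M] (n : ℕ) [ModelCategory (Cube.{v, u} M n)] :
    Prop where
  weakEquivalence_iff {X Y : Cube.{v, u} M n} (f : X ⟶ Y) :
    WeakEquivalence f ↔ ∀ ε : Fin n → Fin 2, WeakEquivalence ((Cube.ev.{v, u} M n ε).map f)
  fibration_iff {X Y : Cube.{v, u} M n} (f : X ⟶ Y) :
    Fibration f ↔ ∀ ε : Fin n → Fin 2, Fibration ((Cube.ev.{v, u} M n ε).map f)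

end Cube

/-! Everything reduces to a single passage from `C` to `Arrow C`, iterated by induction on the
dimension of the cube. Write a map of arrows `f : X ⟶ Y` as a square with source component `f₀` and
target component `f₁`.

Model structure. A weak factorization system `(L, R)` on `C` induces one on `Arrow C`. The right
class asks for `f₀` and `f₁` in `R`. The left class asks for `f₀` and the corner map `X₁ ⊔ Y₀ ⟶ Y₁`
in `L` (the pushout is over `X₀`). Lifts and factorizations are built first at the source and then,
relative to that choice, at the target, as for Reedy diagrams on `0 → 1`. Applied to both systems of
`C`, this gives the projective structure once trivial cofibrations are recognized by
`trivialCofibrations_eq`, which is a two-out-of-three argument. Functorial factorizations are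
inherited because the construction only applies the given factorization twice.

Pushout product axiom. Instead of a generating set, the whole class `L` is used: the cells are
`const i` (a square between identities) and `free i` (a square between arrows with initial source),
for all `i` in `L`. The functors `const` and `free` are left adjoint to evaluation at source and
target, so the cells detect the right class, and the left class is recovered as `llp` of `rlp` of
the cells (`cornerwise_eq_llp_rlp_cells`). No small object argument is involved, since
factorizations are already available. By the two-variable adjunction with the pullback-hom, the
axiom need only be checked on cells. There `const i □ const j` and `const i □ free j` are both
`const (i □ j)`, while `free i □ free j` is `free (i □ j)`, so the axiom in `C` suffices. -/

namespace ProjectiveArrow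

/-! ### Pushouts along the source of an arrow, and corner maps. -/

section Factorization

variable {C : Type u} [Category.{v} C] [HasPushouts C]

/-- The pushout of an arrow `X` along a map `i` out of its source. -/
noncomputable def cobase (X : Arrow C) {E : C} (i : X.left ⟶ E) : C :=
  pushout X.hom i

namespace cobase

/-- The coprojection from the target of the arrow. -/
noncomputable def inl (X : Arrow C) {E : C} (i : X.left ⟶ E) : X.right ⟶ cobase X i :=
  pushout.inl X.hom i

/-- The coprojection from the target of the map. -/
noncomputable def inr (X : Arrow C) {E : C} (i : X.left ⟶ E) : E ⟶ cobase X i :=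
  pushout.inr X.hom i

theorem isPushout (X : Arrow C) {E : C} (i : X.left ⟶ E) :
    IsPushout X.hom i (inl X i) (inr X i) :=
  IsPushout.of_hasPushout _ _

theorem hom_ext {X : Arrow C} {E T : C} {i : X.left ⟶ E} {f g : cobase X i ⟶ T}
    (h : inl X i ≫ f = inl X i ≫ g) (h' : inr X i ≫ f = inr X i ≫ g) : f = g :=
  (isPushout X i).hom_ext h h'

/-- The universal property of the pushout. -/
noncomputable def desc {X : Arrow C} {E T : C} {i : X.left ⟶ E} (a : X.right ⟶ T) (b : E ⟶ T)
    (w : X.hom ≫ a = i ≫ b) : cobase X i ⟶ T :=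
  (isPushout X i).desc a b w

@[simp]
theorem inl_desc {X : Arrow C} {E T : C} {i : X.left ⟶ E} (a : X.right ⟶ T) (b : E ⟶ T)
    (w : X.hom ≫ a = i ≫ b) : inl X i ≫ desc a b w = a :=
  (isPushout X i).inl_desc _ _ _

@[simp]
theorem inl_desc_assoc {X : Arrow C} {E T T' : C} {i : X.left ⟶ E} (a : X.right ⟶ T) (b : E ⟶ T)
    (w : X.hom ≫ a = i ≫ b) (h : T ⟶ T') : inl X i ≫ desc a b w ≫ h = a ≫ h := by
  rw [← Category.assoc, inl_desc]

@[simp]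
theorem inr_desc {X : Arrow C} {E T : C} {i : X.left ⟶ E} (a : X.right ⟶ T) (b : E ⟶ T)
    (w : X.hom ≫ a = i ≫ b) : inr X i ≫ desc a b w = b :=
  (isPushout X i).inr_desc _ _ _

@[simp]
theorem inr_desc_assoc {X : Arrow C} {E T T' : C} {i : X.left ⟶ E} (a : X.right ⟶ T) (b : E ⟶ T)
    (w : X.hom ≫ a = i ≫ b) (h : T ⟶ T') : inr X i ≫ desc a b w ≫ h = b ≫ h := by
  rw [← Category.assoc, inr_desc]

/-- The functoriality of the pushout. -/
noncomputable def map {X X' : Arrow C} {E E' : C} {i : X.left ⟶ E} {i' : X'.left ⟶ E'}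
    (a : X ⟶ X') (b : E ⟶ E') (w : i ≫ b = a.left ≫ i') : cobase X i ⟶ cobase X' i' :=
  desc (a.right ≫ inl X' i') (b ≫ inr X' i') (by
    rw [← Category.assoc, ← Arrow.w, Category.assoc, (isPushout X' i').w, reassoc_of% w])

@[simp]
theorem inl_map {X X' : Arrow C} {E E' : C} {i : X.left ⟶ E} {i' : X'.left ⟶ E'}
    (a : X ⟶ X') (b : E ⟶ E') (w : i ≫ b = a.left ≫ i') :
    inl X i ≫ map a b w = a.right ≫ inl X' i' :=
  inl_desc _ _ _

@[simp]
theorem inl_map_assoc {X X' : Arrow C} {E E' T : C} {i : X.left ⟶ E} {i' : X'.left ⟶ E'}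
    (a : X ⟶ X') (b : E ⟶ E') (w : i ≫ b = a.left ≫ i') (h : cobase X' i' ⟶ T) :
    inl X i ≫ map a b w ≫ h = a.right ≫ inl X' i' ≫ h := by
  rw [← Category.assoc, inl_map, Category.assoc]

@[simp]
theorem inr_map {X X' : Arrow C} {E E' : C} {i : X.left ⟶ E} {i' : X'.left ⟶ E'}
    (a : X ⟶ X') (b : E ⟶ E') (w : i ≫ b = a.left ≫ i') :
    inr X i ≫ map a b w = b ≫ inr X' i' :=
  inr_desc _ _ _

@[simp]
theorem inr_map_assoc {X X' : Arrow C} {E E' T : C} {i : X.left ⟶ E} {i' : X'.left ⟶ E'}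
    (a : X ⟶ X') (b : E ⟶ E') (w : i ≫ b = a.left ≫ i') (h : cobase X' i' ⟶ T) :
    inr X i ≫ map a b w ≫ h = b ≫ inr X' i' ≫ h := by
  rw [← Category.assoc, inr_map, Category.assoc]

theorem map_eq_id {X : Arrow C} {E : C} {i : X.left ⟶ E} {a : X ⟶ X} {b : E ⟶ E}
    (w : i ≫ b = a.left ≫ i) (ha : a = 𝟙 X) (hb : b = 𝟙 E) : map a b w = 𝟙 (cobase X i) := by
  subst ha hb
  apply hom_ext <;> simp

theorem map_comp_map {X X' X'' : Arrow C} {E E' E'' : C} {i : X.left ⟶ E} {i' : X'.left ⟶ E'}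
    {i'' : X''.left ⟶ E''} (a : X ⟶ X') (b : E ⟶ E') (w : i ≫ b = a.left ≫ i')
    (a' : X' ⟶ X'') (b' : E' ⟶ E'') (w' : i' ≫ b' = a'.left ≫ i'') {a'' : X ⟶ X''}
    {b'' : E ⟶ E''} (w'' : i ≫ b'' = a''.left ≫ i'') (ha : a ≫ a' = a'') (hb : b ≫ b' = b'') :
    map a b w ≫ map a' b' w' = map a'' b'' w'' := by
  subst ha hb
  apply hom_ext <;> simp

theorem map_comp_map_eq_id {X X' : Arrow C} {E E' : C} {i : X.left ⟶ E} {i' : X'.left ⟶ E'}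
    (a : X ⟶ X') (b : E ⟶ E') (w : i ≫ b = a.left ≫ i') (a' : X' ⟶ X) (b' : E' ⟶ E)
    (w' : i' ≫ b' = a'.left ≫ i) (ha : a ≫ a' = 𝟙 X) (hb : b ≫ b' = 𝟙 E) :
    map a b w ≫ map a' b' w' = 𝟙 (cobase X i) := by
  apply hom_ext
  · have := congrArg Arrow.Hom.right ha
    rw [Arrow.comp_right, Arrow.id_right] at this
    simp [reassoc_of% this]
  · simp [reassoc_of% hb]

theorem map_desc {X X' : Arrow C} {E E' T T' : C} {i : X.left ⟶ E} {i' : X'.left ⟶ E'}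
    (a : X ⟶ X') (b : E ⟶ E') (w : i ≫ b = a.left ≫ i') {r : X.right ⟶ T} {s : E ⟶ T}
    (h : X.hom ≫ r = i ≫ s) {r' : X'.right ⟶ T'} {s' : E' ⟶ T'} (h' : X'.hom ≫ r' = i' ≫ s')
    (c : T ⟶ T') (hr : a.right ≫ r' = r ≫ c) (hs : b ≫ s' = s ≫ c) :
    map a b w ≫ desc r' s' h' = desc r s h ≫ c := by
  apply hom_ext <;> simp [hr, hs]

end cobase

/-- The corner map `X₁ ⊔ Y₀ ⟶ Y₁` of a square `X ⟶ Y`. -/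
noncomputable def corner {X Y : Arrow C} (f : X ⟶ Y) : cobase X f.left ⟶ Y.right :=
  cobase.desc f.right Y.hom f.w.symm

@[simp]
theorem inl_corner {X Y : Arrow C} (f : X ⟶ Y) : cobase.inl X f.left ≫ corner f = f.right :=
  cobase.inl_desc _ _ _

@[simp]
theorem inl_corner_assoc {X Y : Arrow C} (f : X ⟶ Y) {T : C} (h : Y.right ⟶ T) :
    cobase.inl X f.left ≫ corner f ≫ h = f.right ≫ h := by
  rw [← Category.assoc, inl_corner]

@[simp]
theorem inr_corner {X Y : Arrow C} (f : X ⟶ Y) : cobase.inr X f.left ≫ corner f = Y.hom :=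
  cobase.inr_desc _ _ _

@[simp]
theorem inr_corner_assoc {X Y : Arrow C} (f : X ⟶ Y) {T : C} (h : Y.right ⟶ T) :
    cobase.inr X f.left ≫ corner f ≫ h = Y.hom ≫ h := by
  rw [← Category.assoc, inr_corner]

/-! ### The weak factorization system on squares induced by one on `C`. -/

/-- The class of squares whose source component and corner map belong to `L`. -/
def cornerwise (L : MorphismProperty C) : MorphismProperty (Arrow C) :=
  fun _ _ f ↦ L f.left ∧ L (corner f)

/-- The class of squares whose two components belong to `R`. -/
def vertexwise (R : MorphismProperty C) : MorphismProperty (Arrow C) :=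
  fun _ _ f ↦ R f.left ∧ R f.right

instance (R : MorphismProperty C) [R.IsStableUnderRetracts] :
    (vertexwise R).IsStableUnderRetracts where
  of_retract h hg :=
    ⟨R.of_retract (h.map Arrow.leftFunc) hg.1, R.of_retract (h.map Arrow.rightFunc) hg.2⟩

/-- The corner map is functorial in the square, so a retract of squares induces a retract of corner
maps. -/
instance (L : MorphismProperty C) [L.IsStableUnderRetracts] :
    (cornerwise L).IsStableUnderRetracts where
  of_retract {X Y X' Y' f g} h hg := by
    have hi : h.i.left ≫ g = f ≫ h.i.right := h.i.w
    have hr : h.r.left ≫ f = g ≫ h.r.right := h.r.w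
    have h0 : h.i.left ≫ h.r.left = 𝟙 X := congrArg Arrow.Hom.left h.retract
    have h1 : h.i.right ≫ h.r.right = 𝟙 Y := congrArg Arrow.Hom.right h.retract
    refine ⟨L.of_retract (h.map Arrow.leftFunc) hg.1, L.of_retract ?_ hg.2⟩
    exact
      { i := Arrow.homMk (cobase.map h.i.left (h.i.right).left
          (congrArg Arrow.Hom.left hi).symm) (h.i.right).right
          (cobase.map_desc _ _ _ _ _ _ (congrArg Arrow.Hom.right hi) (h.i.right).w)
        r := Arrow.homMk (cobase.map h.r.left (h.r.right).left
          (congrArg Arrow.Hom.left hr).symm) (h.r.right).right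
          (cobase.map_desc _ _ _ _ _ _ (congrArg Arrow.Hom.right hr) (h.r.right).w)
        retract := Arrow.hom_ext _ _
          (cobase.map_comp_map_eq_id _ _ (congrArg Arrow.Hom.left hi).symm _ _
            (congrArg Arrow.Hom.left hr).symm h0 (congrArg (fun t : Y ⟶ Y ↦ t.left) h1))
          (congrArg (fun t : Y ⟶ Y ↦ t.right) h1) }

/-- Lift at the source first. That lift, composed with `Z.hom`, glues with `u.right` to a map out of
`X₁ ⊔ Y₀`, and a lift of the resulting square against the corner map is the target component. -/
theorem hasLiftingProperty_of_cornerwise {X Y Z W : Arrow C} (f : X ⟶ Y) (p : Z ⟶ W)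
    [HasLiftingProperty f.left p.left] [HasLiftingProperty (corner f) p.right] :
    HasLiftingProperty f p where
  sq_hasLift {u t} sq := by
    have sq₀ : CommSq u.left f.left p.left t.left := ⟨congrArg Arrow.Hom.left sq.w⟩
    have sq₁ : CommSq (cobase.desc u.right (sq₀.lift ≫ Z.hom) (by
        rw [sq₀.fac_left_assoc, Arrow.w])) (corner f) p.right t.right := ⟨by
      apply cobase.hom_ext
      · rw [cobase.inl_desc_assoc, inl_corner_assoc]
        exact congrArg Arrow.Hom.right sq.w
      · rw [cobase.inr_desc_assoc, inr_corner_assoc, Category.assoc, ← Arrow.w p,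
          sq₀.fac_right_assoc, Arrow.w]⟩
    refine ⟨⟨⟨Arrow.homMk sq₀.lift sq₁.lift ?_, ?_, ?_⟩⟩⟩
    -- The upper triangle of the second lift, restricted to `Y₀`, says that the two lifts form a
    -- square; restricted to `X₁`, it gives the upper triangle at the target.
    · rw [← inr_corner f, Category.assoc, sq₁.fac_left, cobase.inr_desc]
    · apply Arrow.hom_ext
      · exact sq₀.fac_left
      · change f.right ≫ sq₁.lift = _
        rw [← inl_corner f, Category.assoc, sq₁.fac_left, cobase.inl_desc]
    · apply Arrow.hom_ext
      · exact sq₀.fac_right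
      · exact sq₁.fac_right

/-- Given a factorization `X₀ ⟶ E ⟶ Y₀` of the source component of a square `X ⟶ Y`, the induced
map `X₁ ⊔ E ⟶ Y₁`. -/
noncomputable def factorCorner {X Y : Arrow C} (f : X ⟶ Y) {E : C} (i : X.left ⟶ E)
    (p : E ⟶ Y.left) (h : i ≫ p = f.left) : cobase X i ⟶ Y.right :=
  cobase.desc f.right (p ≫ Y.hom) (by rw [reassoc_of% h]; exact f.w.symm)

@[simp]
theorem inl_factorCorner {X Y : Arrow C} (f : X ⟶ Y) {E : C} (i : X.left ⟶ E)
    (p : E ⟶ Y.left) (h : i ≫ p = f.left) :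
    cobase.inl X i ≫ factorCorner f i p h = f.right :=
  cobase.inl_desc _ _ _

@[simp]
theorem inr_factorCorner {X Y : Arrow C} (f : X ⟶ Y) {E : C} (i : X.left ⟶ E)
    (p : E ⟶ Y.left) (h : i ≫ p = f.left) :
    cobase.inr X i ≫ factorCorner f i p h = p ≫ Y.hom :=
  cobase.inr_desc _ _ _

/-- The first map of the factorization of a square. -/
noncomputable def factorι {X : Arrow C} {E F : C} (i : X.left ⟶ E)
    (j : cobase X i ⟶ F) : X ⟶ Arrow.mk (cobase.inr X i ≫ j) :=
  Arrow.homMk i (cobase.inl X i ≫ j) (by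
    change i ≫ cobase.inr X i ≫ j = _
    rw [← Category.assoc, ← (cobase.isPushout X i).w, Category.assoc])

/-- The middle arrow `E ⟶ F` is defined through `X₁ ⊔ E`, so the second choice `j` is exactly the
corner map. This is why factoring `factorCorner` is the right second step. -/
theorem corner_factorι {X : Arrow C} {E F : C} (i : X.left ⟶ E) (j : cobase X i ⟶ F) :
    corner (factorι i j) = j := by
  apply cobase.hom_ext
  · exact inl_corner _
  · exact inr_corner _

/-- The second map of the factorization of a square. -/
noncomputable def factorπ {X Y : Arrow C} (f : X ⟶ Y) {E F : C} (i : X.left ⟶ E)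
    (p : E ⟶ Y.left) (h : i ≫ p = f.left) (j : cobase X i ⟶ F) (q : F ⟶ Y.right)
    (h' : j ≫ q = factorCorner f i p h) : Arrow.mk (cobase.inr X i ≫ j) ⟶ Y :=
  Arrow.homMk p q (by
    change p ≫ Y.hom = (cobase.inr X i ≫ j) ≫ q
    rw [Category.assoc, h', inr_factorCorner])

theorem factorι_factorπ {X Y : Arrow C} (f : X ⟶ Y) {E F : C} (i : X.left ⟶ E)
    (p : E ⟶ Y.left) (h : i ≫ p = f.left) (j : cobase X i ⟶ F) (q : F ⟶ Y.right)
    (h' : j ≫ q = factorCorner f i p h) : factorι i j ≫ factorπ f i p h j q h' = f := by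
  apply Arrow.hom_ext
  · exact h
  · change (cobase.inl X i ≫ j) ≫ q = _
    rw [Category.assoc, h', inl_factorCorner]

theorem cornerwise_factorι (L : MorphismProperty C) {X : Arrow C} {E F : C} {i : X.left ⟶ E}
    {j : cobase X i ⟶ F} (hi : L i) (hj : L j) : cornerwise L (factorι i j) :=
  ⟨hi, by rwa [corner_factorι]⟩

/-- Factor `f₀` through `E`, then the induced map `X₁ ⊔ E ⟶ Y₁` through `F`; the middle object is `E
⟶ F`. -/
instance (L R : MorphismProperty C) [L.HasFactorization R] :
    (cornerwise L).HasFactorization (vertexwise R) where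
  nonempty_mapFactorizationData {X _} f :=
    let d := MorphismProperty.factorizationData L R f.left
    let e := MorphismProperty.factorizationData L R (factorCorner f d.i d.p d.fac)
    ⟨{  Z := Arrow.mk (cobase.inr X d.i ≫ e.i)
        i := factorι d.i e.i
        p := factorπ f d.i d.p d.fac e.i e.p e.fac
        fac := factorι_factorπ _ _ _ _ _ _ _
        hi := cornerwise_factorι L d.hi e.hi
        hp := ⟨d.hp, e.hp⟩ }⟩

instance (L R : MorphismProperty C) [L.IsWeakFactorizationSystem R] :
    (cornerwise L).IsWeakFactorizationSystem (vertexwise R) :=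
  -- Classes defined by lifting are closed under retracts. With this closure, factorizations and
  -- lifts are enough for a weak factorization system, by the retract argument.
  have : L.IsStableUnderRetracts := by
    rw [← MorphismProperty.llp_eq_of_wfs L R]; infer_instance
  have : R.IsStableUnderRetracts := by
    rw [← MorphismProperty.rlp_eq_of_wfs L R]; infer_instance
  .mk' _ _ fun i p hi hp ↦
    have := MorphismProperty.hasLiftingProperty_of_wfs _ _ hi.1 hp.1
    have := MorphismProperty.hasLiftingProperty_of_wfs _ _ hi.2 hp.2
    hasLiftingProperty_of_cornerwise i p

/-! ### Functoriality of the two-step factorization. -/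

section Functorial

variable {L R : MorphismProperty C} (d : L.FunctorialFactorizationData R)

/-- The map between the source components of two squares. -/
def sourceMap {f g : Arrow (Arrow C)} (a : f ⟶ g) :
    Arrow.mk f.hom.left ⟶ Arrow.mk g.hom.left :=
  Arrow.homMk a.left.left a.right.left (congrArg Arrow.Hom.left a.w)

/-- The corner map `X₁ ⊔ E ⟶ Y₁` of a square `f : X ⟶ Y` relative to the functorial factorization
`X₀ ⟶ E ⟶ Y₀`. -/
noncomputable def factorCorner' (f : Arrow (Arrow C)) :
    cobase f.left (d.factorizationData f.hom.left).i ⟶ f.right.right :=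
  factorCorner f.hom _ _ (d.factorizationData f.hom.left).fac

/-- The functoriality of `factorCorner'`. -/
noncomputable def factorCornerMap {f g : Arrow (Arrow C)} (a : f ⟶ g) :
    Arrow.mk (factorCorner' d f) ⟶ Arrow.mk (factorCorner' d g) :=
  Arrow.homMk (cobase.map a.left (d.mapZ (sourceMap a)) (d.i_mapZ (sourceMap a))) a.right.right
    (cobase.map_desc _ _ _ _ _ _ (congrArg Arrow.Hom.right a.w) (by
      have h₁ : d.mapZ (sourceMap a) ≫ (d.factorizationData g.hom.left).p =
        (d.factorizationData f.hom.left).p ≫ a.right.left := d.mapZ_p (sourceMap a)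
      rw [reassoc_of% h₁, Arrow.w, Category.assoc]))

theorem factorCornerMap_id (f : Arrow (Arrow C)) : factorCornerMap d (𝟙 f) = 𝟙 _ :=
  Arrow.hom_ext _ _ (cobase.map_eq_id (d.i_mapZ (sourceMap (𝟙 f))) rfl (d.mapZ_id f.hom.left)) rfl

theorem factorCornerMap_comp {f g h : Arrow (Arrow C)} (a : f ⟶ g) (b : g ⟶ h) :
    factorCornerMap d (a ≫ b) = factorCornerMap d a ≫ factorCornerMap d b :=
  Arrow.hom_ext _ _
    (cobase.map_comp_map _ _ (d.i_mapZ (sourceMap a)) _ _ (d.i_mapZ (sourceMap b))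
      (d.i_mapZ (sourceMap (a ≫ b))) rfl (d.mapZ_comp (sourceMap a) (sourceMap b)).symm).symm rfl

/-- The middle object of the functorial factorization of squares. -/
noncomputable def factorFunctor : Arrow (Arrow C) ⥤ Arrow C where
  obj f := Arrow.mk (cobase.inr f.left (d.factorizationData f.hom.left).i ≫
    (d.factorizationData (factorCorner' d f)).i)
  map {f g} a := Arrow.homMk (d.mapZ (sourceMap a)) (d.mapZ (factorCornerMap d a)) (by
    change d.mapZ (sourceMap a) ≫ cobase.inr g.left _ ≫ _ = (cobase.inr f.left _ ≫ _) ≫ _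
    rw [Category.assoc, d.i_mapZ, ← Category.assoc, ← Category.assoc]
    exact congrArg (· ≫ (d.factorizationData (factorCorner' d g)).i)
      (cobase.inr_map a.left _ (d.i_mapZ (sourceMap a))).symm)
  map_id f := Arrow.hom_ext _ _ (d.mapZ_id f.hom.left)
    ((congrArg d.mapZ (factorCornerMap_id d f)).trans (d.mapZ_id _))
  map_comp a b := Arrow.hom_ext _ _ (d.mapZ_comp (sourceMap a) (sourceMap b))
    ((congrArg d.mapZ (factorCornerMap_comp d a b)).trans (d.mapZ_comp _ _))

/-- The functorial factorization of squares. -/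
noncomputable def functorialFactorizationData :
    (cornerwise L).FunctorialFactorizationData (vertexwise R) where
  Z := factorFunctor d
  i :=
    { app f := factorι (X := f.left) (d.factorizationData f.hom.left).i
        (d.factorizationData (factorCorner' d f)).i
      naturality f g a := by
        apply Arrow.hom_ext
        · exact (d.i_mapZ (sourceMap a)).symm
        · change a.left.right ≫ cobase.inl g.left _ ≫ _ =
            (cobase.inl f.left _ ≫ _) ≫ d.mapZ (factorCornerMap d a)
          rw [Category.assoc, d.i_mapZ, ← Category.assoc, ← Category.assoc]
          exact congrArg (· ≫ (d.factorizationData (factorCorner' d g)).i)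
            (cobase.inl_map a.left _ (d.i_mapZ (sourceMap a))).symm }
  p :=
    { app f := factorπ f.hom _ _ (d.factorizationData f.hom.left).fac _ _
        (d.factorizationData (factorCorner' d f)).fac
      naturality f g a := by
        apply Arrow.hom_ext
        · exact d.mapZ_p (sourceMap a)
        · exact d.mapZ_p (factorCornerMap d a) }
  fac := by
    apply NatTrans.ext
    funext f
    exact factorι_factorπ f.hom _ _ (d.factorizationData f.hom.left).fac _ _
      (d.factorizationData (factorCorner' d f)).fac
  hi f := cornerwise_factorι L (d.factorizationData f.hom.left).hi
    (d.factorizationData (factorCorner' d f)).hi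
  hp f := ⟨(d.factorizationData f.hom.left).hp, (d.factorizationData (factorCorner' d f)).hp⟩

end Functorial

end Factorization

/-! ### The projective model structure on arrows. -/

section Model

variable (C : Type u) [Category.{v} C]

instance (W : MorphismProperty C) [W.HasTwoOutOfThreeProperty] :
    (vertexwise W).HasTwoOutOfThreeProperty where
  comp_mem _ _ hf hg := ⟨W.comp_mem _ _ hf.1 hg.1, W.comp_mem _ _ hf.2 hg.2⟩
  of_precomp _ _ hf hg := ⟨W.of_precomp _ _ hf.1 hg.1, W.of_precomp _ _ hf.2 hg.2⟩
  of_postcomp _ _ hf hg := ⟨W.of_postcomp _ _ hf.1 hg.1, W.of_postcomp _ _ hf.2 hg.2⟩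

variable [ModelCategory C]

/-- Projective fibrations of squares. -/
@[reducible] def categoryWithFibrations : CategoryWithFibrations (Arrow C) where
  fibrations := vertexwise (fibrations C)

/-- Projective cofibrations of squares. -/
@[reducible] noncomputable def categoryWithCofibrations : CategoryWithCofibrations (Arrow C) where
  cofibrations := cornerwise (cofibrations C)

/-- Weak equivalences of squares. -/
@[reducible] def categoryWithWeakEquivalences : CategoryWithWeakEquivalences (Arrow C) where
  weakEquivalences := vertexwise (weakEquivalences C)

attribute [local instance] categoryWithFibrations categoryWithCofibrations
  categoryWithWeakEquivalences

theorem trivialFibrations_eq :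
    trivialFibrations (Arrow C) = vertexwise (trivialFibrations C) := by
  ext X Y f
  exact and_and_and_comm

/-- The map `f₁` is the coprojection `X₁ ⟶ X₁ ⊔ Y₀` followed by the corner map. If `f₀` is a trivial
cofibration, so is its cobase change, the coprojection; two-out-of-three then makes `f₁` a weak
equivalence exactly when the corner map is one. -/
theorem trivialCofibrations_eq :
    trivialCofibrations (Arrow C) = cornerwise (trivialCofibrations C) := by
  ext X Y f
  have key (h : trivialCofibrations C f.left) :
      weakEquivalences C f.right ↔ weakEquivalences C (corner f) := by
    have h' := ((trivialCofibrations C).of_isPushout (cobase.isPushout X f.left) h).2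
    rw [← inl_corner f]
    exact (weakEquivalences C).precomp_iff _ _ h'
  constructor
  · rintro ⟨⟨h₁, h₂⟩, h₃, h₄⟩
    exact ⟨⟨h₁, h₃⟩, h₂, (key ⟨h₁, h₃⟩).1 h₄⟩
  · rintro ⟨h, h₂, h₄⟩
    exact ⟨⟨h.1, h₂⟩, h.2, (key h).2 h₄⟩

/-- The projective model structure on the arrow category. -/
@[reducible] noncomputable def modelCategory : ModelCategory (Arrow C) :=
  have : (weakEquivalences (Arrow C)).HasTwoOutOfThreeProperty :=
    inferInstanceAs (vertexwise (weakEquivalences C)).HasTwoOutOfThreeProperty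
  have : (cofibrations (Arrow C)).IsWeakFactorizationSystem (trivialFibrations (Arrow C)) := by
    rw [trivialFibrations_eq]
    exact inferInstanceAs ((cornerwise (cofibrations C)).IsWeakFactorizationSystem
      (vertexwise (trivialFibrations C)))
  have : (trivialCofibrations (Arrow C)).IsWeakFactorizationSystem (fibrations (Arrow C)) := by
    rw [trivialCofibrations_eq]
    exact inferInstanceAs ((cornerwise (trivialCofibrations C)).IsWeakFactorizationSystem
      (vertexwise (fibrations C)))
  ModelCategory.mk' (C := Arrow C)

attribute [local instance] modelCategory

variable {C}

theorem weakEquivalence_iff_left_right {X Y : Arrow C} (f : X ⟶ Y) :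
    WeakEquivalence f ↔ WeakEquivalence f.left ∧ WeakEquivalence f.right := by
  simp only [weakEquivalence_iff]
  rfl

theorem fibration_iff_left_right {X Y : Arrow C} (f : X ⟶ Y) :
    Fibration f ↔ Fibration f.left ∧ Fibration f.right := by
  simp only [fibration_iff]
  rfl

theorem hasFunctorialModelFactorizations (h : HasFunctorialModelFactorizations C) :
    HasFunctorialModelFactorizations (Arrow C) where
  trivialCofibration_fibration := by
    have := h.trivialCofibration_fibration
    constructor
    have e := trivialCofibrations_eq C
    -- Fibrations of squares are vertexwise by definition; only the trivial class has to be
    -- rewritten.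
    exact e ▸ ⟨functorialFactorizationData
      (MorphismProperty.functorialFactorizationData (trivialCofibrations C) (fibrations C))⟩
  cofibration_trivialFibration := by
    have := h.cofibration_trivialFibration
    constructor
    have e := trivialFibrations_eq C
    exact e ▸ ⟨functorialFactorizationData
      (MorphismProperty.functorialFactorizationData (cofibrations C) (trivialFibrations C))⟩

end Model

/-! ### A generating class of cells, with no smallness condition. -/

section Generators

variable (C : Type u) [Category.{v} C]

/-- The functor sending `A` to the identity of `A`. -/
def constFunctor : C ⥤ Arrow C where
  obj A := Arrow.mk (𝟙 A)
  map f := Arrow.homMk f f (by simp)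

/-- The functor sending `A` to `∅ ⟶ A`. -/
noncomputable def freeTarget [HasInitial C] : C ⥤ Arrow C where
  obj A := Arrow.mk (initial.to A)
  map f := Arrow.homMk (𝟙 _) f (initialIsInitial.hom_ext _ _)

/-- Constant squares are left adjoint to evaluation at the source. -/
def constAdjunction : constFunctor C ⊣ Arrow.leftFunc :=
  Adjunction.mkOfHomEquiv
    { homEquiv _ X :=
        { toFun f := f.left
          invFun g := Arrow.homMk g (g ≫ X.hom) (Category.id_comp _).symm
          left_inv f := Arrow.hom_ext _ _ rfl (f.w.trans (Category.id_comp _))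
          right_inv _ := rfl }
      homEquiv_naturality_left_symm _ _ := Arrow.hom_ext _ _ rfl (Category.assoc _ _ _)
      homEquiv_naturality_right _ _ := rfl }

/-- Squares with initial source are left adjoint to evaluation at the target. -/
noncomputable def freeTargetAdjunction [HasInitial C] : freeTarget C ⊣ Arrow.rightFunc :=
  Adjunction.mkOfHomEquiv
    { homEquiv _ _ :=
        { toFun f := f.right
          invFun g := Arrow.homMk (initial.to _) g (initialIsInitial.hom_ext _ _)
          left_inv _ := Arrow.hom_ext _ _ (initialIsInitial.hom_ext _ _) rfl
          right_inv _ := rfl }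
      homEquiv_naturality_left_symm _ _ :=
        Arrow.hom_ext _ _ (initialIsInitial.hom_ext _ _) rfl
      homEquiv_naturality_right _ _ := rfl }

variable {C}

/-- The cells generating the cornerwise class of `L`. -/
inductive cells [HasInitial C] (L : MorphismProperty C) : MorphismProperty (Arrow C)
  | const {A B : C} (i : A ⟶ B) (hi : L i) : cells L ((constFunctor C).map i)
  | free {A B : C} (i : A ⟶ B) (hi : L i) : cells L ((freeTarget C).map i)

/-- By adjunction, lifting against `const i` is lifting of `p.left` against `i`, and lifting against
`free i` is lifting of `p.right` against `i`. -/
theorem rlp_cells [HasInitial C] (L : MorphismProperty C) :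
    (cells L).rlp = vertexwise L.rlp := by
  ext X Y p
  constructor
  · intro h
    exact ⟨fun _ _ i hi ↦ ((constAdjunction C).hasLiftingProperty_iff i p).1 (h _ (.const i hi)),
      fun _ _ i hi ↦ ((freeTargetAdjunction C).hasLiftingProperty_iff i p).1 (h _ (.free i hi))⟩
  · rintro ⟨h₁, h₂⟩ _ _ _ (⟨i, hi⟩ | ⟨i, hi⟩)
    · exact ((constAdjunction C).hasLiftingProperty_iff i p).2 (h₁ _ hi)
    · exact ((freeTargetAdjunction C).hasLiftingProperty_iff i p).2 (h₂ _ hi)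

/-- Stands in for cofibrant generation: the left class is determined by its cells because the weak
factorization system has already been constructed. -/
theorem cornerwise_eq_llp_rlp_cells [HasPushouts C] [HasInitial C] (L R : MorphismProperty C)
    [L.IsWeakFactorizationSystem R] :
    cornerwise L = (cells L).rlp.llp := by
  rw [rlp_cells, MorphismProperty.rlp_eq_of_wfs L R,
    MorphismProperty.llp_eq_of_wfs (cornerwise L) (vertexwise R)]

/-- The structure map of a constant arrow is an identity, so the source component is forced by the
target one. This reduces the naturality checks for `constTensorIso` to target components. -/
theorem constFunctor_hom_ext {X : Arrow C} {A : C} {f g : X ⟶ (constFunctor C).obj A}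
    (h : f.right = g.right) : f = g := by
  refine Arrow.hom_ext _ _ ?_ h
  have hf : f.left = X.hom ≫ f.right := (Category.comp_id _).symm.trans f.w
  have hg : g.left = X.hom ≫ g.right := (Category.comp_id _).symm.trans g.w
  rw [hf, hg, h]

instance : PreservesColimitsOfShape WalkingSpan (constFunctor C) :=
  (constAdjunction C).leftAdjoint_preservesColimits.preservesColimitsOfShape

instance [HasInitial C] : PreservesColimitsOfShape WalkingSpan (freeTarget C) :=
  (freeTargetAdjunction C).leftAdjoint_preservesColimits.preservesColimitsOfShape

end Generators

/-! ### Pushout products of cells and of cornerwise classes. -/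

section Monoidal

open PushoutProductMonoidal

/-- The functor `F` preserves the pushout that defines the source of `f □ g`, and `μ` identifies its
image with the pushout for `G.map f □ H.map g`. Three separate functors are allowed so that the
mixed product of a constant and a free cell is covered. -/
theorem nonempty_pushoutProduct_map_iso
    {C : Type u} [Category.{v} C] [MonoidalCategory C] [HasPushouts C]
    [HasInitial C] [SymmetricCategory C] [MonoidalClosed C]
    {D : Type*} [Category* D] [MonoidalCategory D] [HasPushouts D]
    [HasInitial D] [SymmetricCategory D] [MonoidalClosed D]
    {G H F : C ⥤ D} [PreservesColimitsOfShape WalkingSpan F]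
    (μ : ∀ A B, G.obj A ⊗ H.obj B ≅ F.obj (A ⊗ B))
    (hl : ∀ {A A' : C} (f : A ⟶ A') (B : C),
      G.map f ▷ H.obj B ≫ (μ A' B).hom = (μ A B).hom ≫ F.map (f ▷ B))
    (hr : ∀ (A : C) {B B' : C} (g : B ⟶ B'),
      G.obj A ◁ H.map g ≫ (μ A B').hom = (μ A B).hom ≫ F.map (A ◁ g))
    {A A' B B' : C} (f : A ⟶ A') (g : B ⟶ B') :
    Nonempty (pp (Arrow.mk (G.map f)) (Arrow.mk (H.map g)) ≅
      Arrow.mk (F.map (pp (Arrow.mk f) (Arrow.mk g)).hom)) := by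
  have h₁ := isPushout (Arrow.mk (G.map f)) (Arrow.mk (H.map g))
  have h₂ := (isPushout (Arrow.mk f) (Arrow.mk g)).map F
  have h₃ : IsPushout (G.map f ▷ H.obj B) (G.obj A ◁ H.map g)
      ((μ A' B).hom ≫ F.map (inl (Arrow.mk f) (Arrow.mk g)))
      ((μ A B').hom ≫ F.map (inr (Arrow.mk f) (Arrow.mk g))) :=
    h₂.of_iso' (μ A B) (μ A' B) (μ A B') (Iso.refl _) (hl f B).symm (hr A g).symm
      (Category.comp_id _).symm (Category.comp_id _).symm
  have e₁ := inl_hom (Arrow.mk (G.map f)) (Arrow.mk (H.map g))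
  have e₂ := inr_hom (Arrow.mk (G.map f)) (Arrow.mk (H.map g))
  have e₃ := congrArg F.map (inl_hom (Arrow.mk f) (Arrow.mk g))
  have e₄ := congrArg F.map (inr_hom (Arrow.mk f) (Arrow.mk g))
  rw [F.map_comp] at e₃ e₄
  refine ⟨Arrow.isoMk (h₁.isoIsPushout _ _ h₃) (μ A' B') (h₁.hom_ext ?_ ?_)⟩
  · refine (h₁.inl_isoIsPushout_hom_assoc _ _ h₃ _).trans ?_
    refine (Category.assoc _ _ _).trans (Eq.trans ?_ (Category.assoc _ _ _))
    exact (congrArg ((μ A' B).hom ≫ ·) e₃).trans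
      ((hr A' g).symm.trans (congrArg (· ≫ (μ A' B').hom) e₁.symm))
  · refine (h₁.inr_isoIsPushout_hom_assoc _ _ h₃ _).trans ?_
    refine (Category.assoc _ _ _).trans (Eq.trans ?_ (Category.assoc _ _ _))
    exact (congrArg ((μ A B').hom ≫ ·) e₄).trans
      ((hl f B').symm.trans (congrArg (· ≫ (μ A' B').hom) e₂.symm))

/-- For fixed `g` and `p`, lifting `f □ g` against `p` is lifting `f` against a pullback-hom, so `f`
may be taken in `W₁`. The adjunction in the other variable then reduces `g` to `W₂`. -/
theorem hasLiftingProperty_pushoutProduct_of_generators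
    {D : Type u} [Category.{v} D] [MonoidalCategory D] [HasPushouts D] [HasPullbacks D]
    [HasInitial D] [SymmetricCategory D] [MonoidalClosed D] {W₁ W₂ R : MorphismProperty D}
    (h : ∀ {A B K L X Y : D} (f : A ⟶ B) (g : K ⟶ L) (p : X ⟶ Y), W₁ f → W₂ g → R p →
      HasLiftingProperty (pp (Arrow.mk f) (Arrow.mk g)).hom p)
    {A B K L X Y : D} {f : A ⟶ B} {g : K ⟶ L} {p : X ⟶ Y}
    (hf : W₁.rlp.llp f) (hg : W₂.rlp.llp g) (hp : R p) :
    HasLiftingProperty (pp (Arrow.mk f) (Arrow.mk g)).hom p :=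
  Arrow.PushoutProduct.hasLiftingProperty_mk_iff'.2 <| hf _ fun _ _ f' hf' ↦
    Arrow.PushoutProduct.hasLiftingProperty_mk_iff'.1 <|
      Arrow.PushoutProduct.hasLiftingProperty_mk_iff.2 <| hg _ fun _ _ g' hg' ↦
        Arrow.PushoutProduct.hasLiftingProperty_mk_iff.1 <| h f' g' p hf' hg' hp

variable {C : Type u} [Category.{v} C] [MonoidalCategory C] [HasPushouts C]
    [HasInitial C] [SymmetricCategory C] [MonoidalClosed C]

/-- The pushout product of two arrows with initial source has initial source. -/
noncomputable def isInitialLeft (A B : C) :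
    IsInitial (pp ((freeTarget C).obj A) ((freeTarget C).obj B)).left :=
  IsInitial.ofUniqueHom
    (fun _ ↦ (isPushout _ _).desc ((isInitialTensor A).to _) ((isInitialTensor' B).to _)
      ((isInitialTensor' (⊥_ C)).hom_ext _ _))
    (fun _ _ ↦ left_ext ((isInitialTensor A).hom_ext _ _) ((isInitialTensor' B).hom_ext _ _))

/-- `freeTarget` is monoidal. -/
noncomputable def freeTargetTensorIso (A B : C) :
    (freeTarget C).obj A ⊗ (freeTarget C).obj B ≅ (freeTarget C).obj (A ⊗ B) :=
  Arrow.isoMk ((isInitialLeft A B).uniqueUpToIso initialIsInitial) (Iso.refl _)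
    ((isInitialLeft A B).hom_ext _ _)

/-- The pushout product of an identity with an arrow. -/
noncomputable def constTensorIso (A : C) (X : Arrow C) :
    (constFunctor C).obj A ⊗ X ≅ (constFunctor C).obj (A ⊗ X.right) :=
  Arrow.isoMk
    { hom := (pp ((constFunctor C).obj A) X).hom
      inv := inr ((constFunctor C).obj A) X
      hom_inv_id := by
        -- One leg of the defining pushout is an identity, so `inl` factors through `inr`, which is
        -- therefore an isomorphism.
        have h : inl ((constFunctor C).obj A) X = A ◁ X.hom ≫ inr ((constFunctor C).obj A) X := by
          have := glue ((constFunctor C).obj A) X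
          refine Eq.trans ?_ this
          exact ((congrArg (· ≫ inl ((constFunctor C).obj A) X) (id_whiskerRight A X.left)).trans
            (Category.id_comp _)).symm
        apply left_ext
        · refine (Category.assoc _ _ _).symm.trans (Eq.trans ?_ (Category.comp_id _).symm)
          exact (congrArg (· ≫ inr ((constFunctor C).obj A) X) (inl_hom _ X)).trans h.symm
        · refine (Category.assoc _ _ _).symm.trans (Eq.trans ?_ (Category.comp_id _).symm)
          refine (congrArg (· ≫ inr ((constFunctor C).obj A) X) (inr_hom _ X)).trans ?_
          exact (congrArg (· ≫ inr ((constFunctor C).obj A) X)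
            (id_whiskerRight A X.right)).trans (Category.id_comp _)
      inv_hom_id := (inr_hom _ _).trans (id_whiskerRight A X.right) }
    (Iso.refl _) rfl

-- The pushout products of cells are formed over `Arrow C`, whose closed structure is given by
-- pullback-homs.
variable [HasPullbacks C]

theorem nonempty_const_const {A A' B B' : C} (f : A ⟶ A') (g : B ⟶ B') :
    Nonempty (pp (Arrow.mk ((constFunctor C).map f)) (Arrow.mk ((constFunctor C).map g)) ≅
      Arrow.mk ((constFunctor C).map (pp (Arrow.mk f) (Arrow.mk g)).hom)) :=
  nonempty_pushoutProduct_map_iso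
    (fun A B ↦ constTensorIso A ((constFunctor C).obj B))
    (fun f B ↦ constFunctor_hom_ext
      ((Category.comp_id (f ▷ B)).trans (Category.id_comp (f ▷ B)).symm))
    (fun A _ _ g ↦ constFunctor_hom_ext
      ((Category.comp_id (A ◁ g)).trans (Category.id_comp (A ◁ g)).symm)) f g

theorem nonempty_const_free {A A' B B' : C} (f : A ⟶ A') (g : B ⟶ B') :
    Nonempty (pp (Arrow.mk ((constFunctor C).map f)) (Arrow.mk ((freeTarget C).map g)) ≅
      Arrow.mk ((constFunctor C).map (pp (Arrow.mk f) (Arrow.mk g)).hom)) :=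
  nonempty_pushoutProduct_map_iso
    (fun A B ↦ constTensorIso A ((freeTarget C).obj B))
    (fun f B ↦ constFunctor_hom_ext
      ((Category.comp_id (f ▷ B)).trans (Category.id_comp (f ▷ B)).symm))
    (fun A _ _ g ↦ constFunctor_hom_ext
      ((Category.comp_id (A ◁ g)).trans (Category.id_comp (A ◁ g)).symm)) f g

theorem nonempty_free_free {A A' B B' : C} (f : A ⟶ A') (g : B ⟶ B') :
    Nonempty (pp (Arrow.mk ((freeTarget C).map f)) (Arrow.mk ((freeTarget C).map g)) ≅
      Arrow.mk ((freeTarget C).map (pp (Arrow.mk f) (Arrow.mk g)).hom)) :=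
  nonempty_pushoutProduct_map_iso freeTargetTensorIso
    (fun f B ↦ Arrow.hom_ext _ _ ((isInitialLeft _ _).hom_ext _ _)
      ((Category.comp_id (f ▷ B)).trans (Category.id_comp (f ▷ B)).symm))
    (fun A _ _ g ↦ Arrow.hom_ext _ _ ((isInitialLeft _ _).hom_ext _ _)
      ((Category.comp_id (A ◁ g)).trans (Category.id_comp (A ◁ g)).symm)) f g

theorem hasLiftingProperty_pushoutProduct_cells {L₁ L₂ L₃ : MorphismProperty C}
    (h : ∀ {A B K L : C} (f : A ⟶ B) (g : K ⟶ L), L₁ f → L₂ g →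
      L₃ (pp (Arrow.mk f) (Arrow.mk g)).hom)
    {A B K L X Y : Arrow C} (f : A ⟶ B) (g : K ⟶ L) (p : X ⟶ Y) (hf : cells L₁ f)
    (hg : cells L₂ g) (hp : vertexwise L₃.rlp p) :
    HasLiftingProperty (pp (Arrow.mk f) (Arrow.mk g)).hom p := by
  obtain ⟨i, hi⟩ | ⟨i, hi⟩ := hf <;> obtain ⟨j, hj⟩ | ⟨j, hj⟩ := hg
  · refine (HasLiftingProperty.iff_of_arrow_iso_left (nonempty_const_const i j).some p).2 ?_
    exact ((constAdjunction C).hasLiftingProperty_iff _ p).2 (hp.1 _ (h i j hi hj))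
  · refine (HasLiftingProperty.iff_of_arrow_iso_left (nonempty_const_free i j).some p).2 ?_
    exact ((constAdjunction C).hasLiftingProperty_iff _ p).2 (hp.1 _ (h i j hi hj))
  -- The braiding is needed twice: among squares, to put the constant cell first, and then in `C`,
  -- to turn `j □ i` back into `i □ j`, the order to which `h` applies.
  · refine (HasLiftingProperty.iff_of_arrow_iso_left
      (braidIso _ _ ≪≫ (nonempty_const_free j i).some) p).2 ?_
    refine ((constAdjunction C).hasLiftingProperty_iff _ p).2 ?_
    exact (HasLiftingProperty.iff_of_arrow_iso_left (braidIso (Arrow.mk j) (Arrow.mk i)) _).2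
      (hp.1 _ (h i j hi hj))
  · refine (HasLiftingProperty.iff_of_arrow_iso_left (nonempty_free_free i j).some p).2 ?_
    exact ((freeTargetAdjunction C).hasLiftingProperty_iff _ p).2 (hp.2 _ (h i j hi hj))

/-- Three independent classes let one statement serve for the product of two cofibrations and for
both cases with a trivial factor. -/
theorem cornerwise_pushoutProduct {L₁ L₂ L₃ : MorphismProperty C} (R₁ R₂ R₃ : MorphismProperty C)
    [L₁.IsWeakFactorizationSystem R₁] [L₂.IsWeakFactorizationSystem R₂]
    [L₃.IsWeakFactorizationSystem R₃]
    (h : ∀ {A B K L : C} (f : A ⟶ B) (g : K ⟶ L), L₁ f → L₂ g →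
      L₃ (pp (Arrow.mk f) (Arrow.mk g)).hom)
    {A B K L : Arrow C} {f : A ⟶ B} {g : K ⟶ L} (hf : cornerwise L₁ f) (hg : cornerwise L₂ g) :
    cornerwise L₃ (pp (Arrow.mk f) (Arrow.mk g)).hom := by
  rw [cornerwise_eq_llp_rlp_cells L₁ R₁] at hf
  rw [cornerwise_eq_llp_rlp_cells L₂ R₂] at hg
  rw [cornerwise_eq_llp_rlp_cells L₃ R₃, rlp_cells]
  intro X Y p hp
  exact hasLiftingProperty_pushoutProduct_of_generators
    (hasLiftingProperty_pushoutProduct_cells h) hf hg hp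

end Monoidal

/-! ### The pushout product axiom for arrows. -/

/-- The projective model structure on the arrow category of a monoidal model category is monoidal
for the pushout product. -/
@[reducible] noncomputable def monoidalModelCategory (C : Type u) [Category.{v} C] [HasLimits C]
    [HasColimits C] [MonoidalCategory C] [SymmetricCategory C] [MonoidalClosed C]
    [MonoidalModelCategory C] : MonoidalModelCategory (Arrow C) where
  toModelCategory := modelCategory C
  cofibration_pushoutProduct f g hf hg := by
    rw [cofibration_iff] at hf hg ⊢
    refine cornerwise_pushoutProduct (trivialFibrations C) (trivialFibrations C)
      (trivialFibrations C) (fun i j hi hj ↦ ?_) hf hg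
    rw [← cofibration_iff] at hi hj ⊢
    exact MonoidalModelCategory.cofibration_pushoutProduct i j hi hj
  weakEquivalence_pushoutProduct f g hf hg h := by
    rw [cofibration_iff] at hf hg
    rw [weakEquivalence_iff, weakEquivalence_iff] at h
    rw [weakEquivalence_iff]
    let := modelCategory C
    -- Weak equivalences alone are not a cornerwise class; trivial cofibrations are, so the stronger
    -- claim is the one accessible through cells.
    suffices trivialCofibrations (Arrow C)
      ((Arrow.pushoutProduct.obj (Arrow.mk f)).obj (Arrow.mk g)).hom from this.2
    rw [trivialCofibrations_eq]
    rcases h with h | h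
    · have hf' : cornerwise (trivialCofibrations C) f := by
        rw [← trivialCofibrations_eq]
        exact ⟨hf, h⟩
      refine cornerwise_pushoutProduct (fibrations C) (trivialFibrations C)
        (fibrations C) (fun i j hi hj ↦ ?_) hf' hg
      rw [mem_trivialCofibrations_iff] at hi ⊢
      rw [← cofibration_iff] at hj
      exact ⟨MonoidalModelCategory.cofibration_pushoutProduct i j hi.1 hj,
        MonoidalModelCategory.weakEquivalence_pushoutProduct i j hi.1 hj (.inl hi.2)⟩
    · have hg' : cornerwise (trivialCofibrations C) g := by
        rw [← trivialCofibrations_eq]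
        exact ⟨hg, h⟩
      refine cornerwise_pushoutProduct (trivialFibrations C) (fibrations C)
        (fibrations C) (fun i j hi hj ↦ ?_) hf hg'
      rw [mem_trivialCofibrations_iff] at hj ⊢
      rw [← cofibration_iff] at hi
      exact ⟨MonoidalModelCategory.cofibration_pushoutProduct i j hi hj.1,
        MonoidalModelCategory.weakEquivalence_pushoutProduct i j hi hj.1 (.inr hj.2)⟩

end ProjectiveArrow

/-! ### Induction on the dimension of the cube. -/

/-- The first coordinate of a vertex selects source or target in `Cube.ev`, so this splits a
vertexwise condition into one on each of the two opposite faces. -/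
theorem Cube.forall_vertex_succ {n : ℕ} {P : (Fin (n + 1) → Fin 2) → Prop} :
    (∀ ε, P ε) ↔ (∀ ε, P (Fin.cons 0 ε)) ∧ ∀ ε, P (Fin.cons 1 ε) := by
  refine ⟨fun h ↦ ⟨fun _ ↦ h _, fun _ ↦ h _⟩, fun h ε ↦ ?_⟩
  rw [← Fin.cons_self_tail ε]
  match ε 0 with
  | 0 => exact h.1 _
  | 1 => exact h.2 _

theorem mainTheorem2 {M : Type (max u v)} [Category.{v} M] [HasLimits M] [HasColimits M]
    [MonoidalCategory M] [SymmetricCategory M] [MonoidalClosed M] [MonoidalModelCategory M]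
    (n : ℕ) :
    ∃ S : MonoidalModelCategory (Cube.{v, u} M n),
      Cube.IsProjective.{v, u} M n ∧
      (HasFunctorialModelFactorizations M →
        HasFunctorialModelFactorizations (Cube.{v, u} M n)) := by
  induction n with
  | zero =>
    let : MonoidalModelCategory (Cube.{v, u} M 0) := inferInstanceAs (MonoidalModelCategory M)
    exact ⟨this,
      -- A `0`-cube has one vertex, the empty function, and evaluation there is the identity
      -- functor.
      ⟨fun f ↦ ⟨fun h _ ↦ h, fun h ↦ h Fin.elim0⟩, fun f ↦ ⟨fun h _ ↦ h, fun h ↦ h Fin.elim0⟩⟩,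
      id⟩
  | succ n ih =>
    obtain ⟨_, hS, hF⟩ := ih
    let S' : MonoidalModelCategory (Cube.{v, u} M (n + 1)) :=
      ProjectiveArrow.monoidalModelCategory (Cube.{v, u} M n)
    refine ⟨S', ⟨fun f ↦ ?_, fun f ↦ ?_⟩,
      fun h ↦ ProjectiveArrow.hasFunctorialModelFactorizations (hF h)⟩
    · refine (ProjectiveArrow.weakEquivalence_iff_left_right (C := Cube.{v, u} M n) f).trans ?_
      rw [Cube.forall_vertex_succ]
      -- Evaluation at `Fin.cons 0 ε` or `Fin.cons 1 ε` is, by definition, the source or target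
      -- functor followed by evaluation at `ε`.
      exact and_congr (hS.weakEquivalence_iff f.left) (hS.weakEquivalence_iff f.right)
    · refine (ProjectiveArrow.fibration_iff_left_right (C := Cube.{v, u} M n) f).trans ?_
      rw [Cube.forall_vertex_succ]
      exact and_congr (hS.fibration_iff f.left) (hS.fibration_iff f.right)
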